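/- **Setting.** In online local learning with $n$ items, $L$ labels and $T$ rounds, in each round $t$ the learner sees a pair of items $(i_t,j_t)\in[n]^2$, answers with a pair of labels $(a_t,b_t)\in[L]^2$ and is then shown a payoff function $\mathcal P^t:[L]^2\to[-1,1]$ (with rational values); its payoff in the round is $\mathcal P^t(a_t,b_t)$. Its regret on a fixed sequence of pairs and payoff functions is $$\max_{l\in[L]^n}\sum_{t=1}^T\mathcal P^t(l(i_t),l(j_t))-\mathbb E\Big[\sum_{t=1}^T\mathcal P^t(a_t,b_t)\Big],$$ where the expectation is over the learner's coins. A (randomized) learner runs in polynomial time if it computes its answers in time polynomial in $n$, $L$, $T$ and the length of the description of the payoff functions shown so far. We say that regret $\sqrt{nL^{\beta}T}$ is achievable in polynomial time if there are a polynomial-time learner and a constant $C$ such that, for all $n,L,T\ge1$ and all sequences, its regret is at most $C\sqrt{nL^{\beta}T}$. $G(n,p)$ is the random graph on $n$ vertices in which each pair is an edge independently with probability $p$. $G(n,p,k,q)$ is the random graph obtained by choosing a uniformly random set $S$ of $k$ vertices and then, independently, joining each pair inside $S$ with probability $q$ and each other pair with probability $p$. For sequences $p=p(n)$, $k=k(n)$,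 $q=q(n)$, one can distinguish $G(n,p)$ from $G(n,p,k,q)$ in polynomial time with probability $\frac45$ if there is a randomized polynomial-time algorithm which, for all sufficiently large $n$, answers "random" with probability at least $\frac45$ on a graph from $G(n,p)$ and answers "planted" with probability at least $\frac45$ on a graph from $G(n,p,k,q)$. The planted dense subgraph conjecture states: for all constants $0<\epsilon'<\frac12$, $0<\alpha\le\frac12$, $\epsilon>0$, with $k=\lfloor n^{1/2-\epsilon'}\rfloor$, $p=n^{-\alpha}$, $q=k^{-\alpha-\epsilon}$, if $p=o(q)$, then $G(n,p)$ and $G(n,p,k,q)$ cannot be distinguished in polynomial time with probability $\frac45$. **Corollary 2.** Let $\epsilon',\alpha,\epsilon>0$ be constants with $\alpha\ge\epsilon$. If regret $\sqrt{nL^{1-\epsilon'-\alpha-\epsilon}T}$ is achievable in polynomial time, then one can distinguish $G(n,p_s)$ from $G(n,p_s,k,p_d)$ in polynomial time with probability $\frac45$, where $p_s=n^{-\alpha/8}$, $k=\lfloor n^{1/2-\epsilon'/4}\rfloor$, $p_d=k^{-\alpha/8-\epsilon/8}$. In particular, if the planted dense subgraph conjecture is true, then for every constant $\delta>0$ regret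 $\sqrt{nL^{1-\delta}T}$ is not achievable in polynomial time. -/

import Mathlib

open MeasureTheory ProbabilityTheory Filter

/-! ## A machine model: while-programs on binary trees, with a step count -/

/-- The data on which programs operate: binary trees, as in Lisp. -/
inductive Data : Type
  | nil : Data
  | cons : Data → Data → Data

namespace Data

/-- The number of nodes of a tree. -/
def size : Data → ℕ
  | nil => 1
  | cons a b => 1 + a.size + b.size

/-- The first component (`nil` has first component `nil`). -/
def head : Data → Data
  | nil => nil
  | cons a _ => a

/-- The second component (`nil` has second component `nil`). -/
def tail : Data → Data
  | nil => nil
  | cons _ b => b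

/-- Booleans as trees. -/
def ofBool : Bool → Data
  | false => nil
  | true => cons nil nil

/-- Natural numbers in unary. -/
def ofNat : ℕ → Data
  | 0 => nil
  | n + 1 => cons nil (ofNat n)

/-- Lists as nested pairs. -/
def ofList {X : Type} (enc : X → Data) : List X → Data
  | [] => nil
  | x :: xs => cons (enc x) (ofList enc xs)

/-- Finite sequences of trees as lists. -/
def ofSeq {m : ℕ} (f : Fin m → Data) : Data :=
  ofList (fun d => d) (List.ofFn f)

/-- A rational number: its sign, and its numerator and denominator in binary. -/
def ofRat (r : ℚ) : Data :=
  cons (ofBool (decide (r.num < 0)))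
    (cons (ofList ofBool r.num.natAbs.bits) (ofList ofBool r.den.bits))

open Classical in
/-- A graph on `n` vertices: its adjacency matrix, row by row. -/
noncomputable def ofGraph {n : ℕ} (G : SimpleGraph (Fin n)) : Data :=
  ofSeq fun u => ofSeq fun v => ofBool (decide (G.Adj u v))

end Data

/-- Programs that transform one tree: the one-variable while-language. -/
inductive Prog : Type
  | id : Prog
  | nil : Prog
  | head : Prog
  | tail : Prog
  /-- run both programs on the current tree and pair the results -/
  | pair : Prog → Prog → Prog
  /-- sequential composition: first program first -/
  | seq : Prog → Prog → Prog
  /-- `ite c f g`: run `f` if the value of `c` is not `nil`, otherwise `g` -/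
  | ite : Prog → Prog → Prog → Prog
  /-- `loop c f`: while the value of `c` is not `nil`, run `f` -/
  | loop : Prog → Prog → Prog

/-- `P.Run x t y`: on input `x`, the program `P` halts with output `y`, at cost exactly `t`.
A basic instruction costs one more than the size of the tree that it reads, so the cost bounds the
size of everything that is read or written. -/
inductive Prog.Run : Prog → Data → ℕ → Data → Prop
  | id (x : Data) : Run .id x (1 + x.size) x
  | nil (x : Data) : Run .nil x (1 + x.size) .nil
  | head (x : Data) : Run .head x (1 + x.size) x.head
  | tail (x : Data) : Run .tail x (1 + x.size) x.tail
  | pair {f g : Prog} {x y z : Data} {s t : ℕ} (hf : Run f x s y) (hg : Run g x t z) :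
      Run (.pair f g) x (1 + s + t) (.cons y z)
  | seq {f g : Prog} {x y z : Data} {s t : ℕ} (hf : Run f x s y) (hg : Run g y t z) :
      Run (.seq f g) x (1 + s + t) z
  | ite_true {c f g : Prog} {x a b y : Data} {s t : ℕ} (hc : Run c x s (.cons a b))
      (hf : Run f x t y) : Run (.ite c f g) x (1 + s + t) y
  | ite_false {c f g : Prog} {x y : Data} {s t : ℕ} (hc : Run c x s .nil)
      (hg : Run g x t y) : Run (.ite c f g) x (1 + s + t) y
  | loop_stop {c f : Prog} {x : Data} {s : ℕ} (hc : Run c x s .nil) :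
      Run (.loop c f) x (1 + s) x
  | loop_step {c f : Prog} {x a b y z : Data} {s t u : ℕ} (hc : Run c x s (.cons a b))
      (hf : Run f x t y) (hl : Run (.loop c f) y u z) :
      Run (.loop c f) x (1 + s + t + u) z

/-- Some program computes `out i` from `inp i`, for every `i`, in time polynomial in the size
of `inp i`. -/
def ComputableInPolyTime {ι : Type} (inp out : ι → Data) : Prop :=
  ∃ (P : Prog) (q : Polynomial ℕ), ∀ i, ∃ t ≤ q.eval (inp i).size, P.Run (inp i) t (out i)

/-- The law of `m` independent fair coin tosses. -/
noncomputable def coinLaw (m : ℕ) : Measure (Fin m → Bool) :=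
  uniformOn Set.univ

/-! ## Online local learning -/

/-- What one round shows: a pair of items and a payoff function with values in `[-1, 1]`. -/
structure Round (n L : ℕ) : Type where
  i : Fin n
  j : Fin n
  payoff : Fin L → Fin L → ℚ
  abs_payoff_le : ∀ a b, |payoff a b| ≤ 1

/-- What the learner has seen when it must choose labels: the completed rounds (in order of time,
with their payoff functions) and the current pair of items. -/
structure View (n L T : ℕ) : Type where
  past : List (Round n L)
  past_lt : past.length < T
  i : Fin n
  j : Fin n

/-- The view in round `t` of a play with the rounds `x`. -/
def viewAt {n L T : ℕ} (x : Fin T → Round n L) (t : Fin T) : View n L T where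
  past := (List.ofFn x).take t
  past_lt := by simp
  i := (x t).i
  j := (x t).j

/-- A randomized learner. At the start it tosses a number of fair coins that is polynomial
in `n + L + T`; in each round its two labels are a function of the parameters, the coins and
what it has seen so far. -/
structure Learner : Type where
  coins : Polynomial ℕ
  label : (n L T : ℕ+) → (Fin (coins.eval (n + L + T : ℕ)) → Bool) → View n L T →
    Fin L × Fin L

/-- A round as a tree. -/
def Round.toData {n L : ℕ} (x : Round n L) : Data :=
  .cons (.ofNat x.i) (.cons (.ofNat x.j)
    (.ofSeq fun a => .ofSeq fun b => .ofRat (x.payoff a b)))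

/-- A view as a tree. -/
def View.toData {n L T : ℕ} (v : View n L T) : Data :=
  .cons (.ofList Round.toData v.past) (.cons (.ofNat v.i) (.ofNat v.j))

namespace Learner

/-- The labels of each round are computed in time polynomial in `n`, `L`, `T` (given in unary)
and the length of the description of what the learner has seen. -/
def PolyTime (A : Learner) : Prop :=
  ComputableInPolyTime
    (ι := (n : ℕ+) × (L : ℕ+) × (T : ℕ+) ×
      (Fin (A.coins.eval (n + L + T : ℕ)) → Bool) × View n L T)
    (fun ⟨n, L, T, r, v⟩ =>
      .cons (.ofNat n) (.cons (.ofNat L) (.cons (.ofNat T) (.cons (.ofSeq fun s => .ofBool (r s))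
        v.toData))))
    (fun ⟨n, L, T, r, v⟩ =>
      .cons (.ofNat (A.label n L T r v).1) (.ofNat (A.label n L T r v).2))

/-- The total payoff of the learner with coins `r`. -/
def totalPayoff (A : Learner) {n L T : ℕ+} (x : Fin T → Round n L)
    (r : Fin (A.coins.eval (n + L + T : ℕ)) → Bool) : ℝ :=
  ∑ t, ((x t).payoff (A.label n L T r (viewAt x t)).1 (A.label n L T r (viewAt x t)).2 : ℝ)

/-- The expected total payoff, over the learner's coins. -/
noncomputable def expectedPayoff (A : Learner) {n L T : ℕ+} (x : Fin T → Round n L) : ℝ :=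
  ∫ r, A.totalPayoff x r ∂(coinLaw (A.coins.eval (n + L + T : ℕ)))

end Learner

/-- The payoff of the best fixed labeling of the items. -/
noncomputable def bestPayoff {n L T : ℕ+} (x : Fin T → Round n L) : ℝ :=
  ⨆ l : Fin n → Fin L, ∑ t, ((x t).payoff (l (x t).i) (l (x t).j) : ℝ)

/-- The learner has regret `O(√(n L ^ β T))`, on every sequence of rounds. -/
def Learner.AchievesRegret (A : Learner) (β : ℝ) : Prop :=
  ∃ C : ℝ, ∀ (n L T : ℕ+) (x : Fin T → Round n L),
    bestPayoff x - A.expectedPayoff x ≤ C * √((n : ℝ) * (L : ℝ) ^ β * (T : ℝ))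

/-! ## Planted dense subgraphs -/

/-- The graph that agrees with `K` on the pairs inside `S` and with `H` on all other pairs. -/
def splice {V : Type} (S : Finset V) (H K : SimpleGraph V) : SimpleGraph V where
  Adj u v := ((u ∈ S ∧ v ∈ S) ∧ K.Adj u v) ∨ (¬ (u ∈ S ∧ v ∈ S) ∧ H.Adj u v)
  symm := ⟨fun u v h => by
    rw [and_comm (a := v ∈ S), K.adj_comm, H.adj_comm]; exact h⟩
  loopless := ⟨fun u h => by simp at h⟩

/-- A real number of `[0, 1]` as an element of the unit interval (other numbers are truncated). -/
noncomputable def toProb (p : ℝ) : unitInterval := Set.projIcc 0 1 zero_le_one p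

/-- The ensemble `G(n, p)`. -/
noncomputable def randomGraph (n : ℕ) (p : ℝ) : Measure (SimpleGraph (Fin n)) :=
  SimpleGraph.binomialRandom (Fin n) (toProb p)

/-- The ensemble `G(n, p, k, q)`, for `k ≤ n`: a uniformly random set `S` of `k` vertices; then,
independently, each pair inside `S` is an edge with probability `q` and each other pair is an edge
with probability `p`. -/
noncomputable def plantedGraph (n : ℕ) (p : ℝ) (k : ℕ) (q : ℝ) : Measure (SimpleGraph (Fin n)) :=
  ∑ S ∈ (Finset.univ : Finset (Fin n)).powersetCard k, (n.choose k : ENNReal)⁻¹ •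
    ((randomGraph n p).prod (randomGraph n q)).map (fun x => splice S x.1 x.2)

/-- A randomized decision procedure for graphs, which tosses a number of fair coins that is
polynomial in the number of vertices. The answer `true` means `planted`. -/
structure Distinguisher : Type where
  coins : Polynomial ℕ
  answer : (n : ℕ) → (Fin (coins.eval n) → Bool) → SimpleGraph (Fin n) → Bool

namespace Distinguisher

/-- The answer is computed in time polynomial in the size of the graph. -/
def PolyTime (D : Distinguisher) : Prop :=
  ComputableInPolyTime
    (ι := (n : ℕ) × (Fin (D.coins.eval n) → Bool) × SimpleGraph (Fin n))
    (fun ⟨_, r, G⟩ => .cons (.ofSeq fun s => .ofBool (r s)) (.ofGraph G))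
    (fun ⟨n, r, G⟩ => .ofBool (D.answer n r G))

/-- The probability of the answer `b` on a random graph with law `μ`. -/
noncomputable def answerProb (D : Distinguisher) {n : ℕ} (μ : Measure (SimpleGraph (Fin n)))
    (b : Bool) : ℝ :=
  (μ.prod (coinLaw (D.coins.eval n))).real {x | D.answer n x.2 x.1 = b}

/-- For all large `n`, the answer is right with probability at least `4/5` on a graph
from `G(n, p)` and also on a graph from `G(n, p, k, q)`. -/
def Distinguishes (D : Distinguisher) (p : ℕ → ℝ) (k : ℕ → ℕ) (q : ℕ → ℝ) : Prop :=
  ∀ᶠ n in atTop,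
    4 / 5 ≤ D.answerProb (randomGraph n (p n)) false ∧
    4 / 5 ≤ D.answerProb (plantedGraph n (p n) (k n) (q n)) true

end Distinguisher

/-- `n ^ (1/2 - ε')`, rounded down. -/
noncomputable def plantedSize (ε' : ℝ) (n : ℕ) : ℕ := ⌊(n : ℝ) ^ (1 / 2 - ε')⌋₊

/-- The planted dense subgraph conjecture: for all constants `0 < ε' < 1/2`, `0 < α ≤ 1/2` and
`0 < ε`, with `k = n ^ (1/2 - ε')`, `p = n ^ (-α)` and `q = k ^ (-α - ε)`, if `p = o(q)` then no
polynomial-time algorithm distinguishes `G(n, p)` from `G(n, p, k, q)`. -/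
def PlantedDenseSubgraphConjecture : Prop :=
  ∀ ε' α ε : ℝ, 0 < ε' → ε' < 1 / 2 → 0 < α → α ≤ 1 / 2 → 0 < ε →
    (fun n : ℕ => (n : ℝ) ^ (-α)) =o[atTop]
      (fun n : ℕ => (plantedSize ε' n : ℝ) ^ (-α - ε)) →
    ¬ ∃ D : Distinguisher, D.PolyTime ∧
      D.Distinguishes (fun n => (n : ℝ) ^ (-α)) (plantedSize ε')
        (fun n => (plantedSize ε' n : ℝ) ^ (-α - ε))

/-! ## Programs: closure properties of polynomial-time computability -/

/-! The learner itself serves as the test. Cut the `N` vertices of a graph into `2m` blocks of `L ≈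
N / (2m)` vertices, where `m ≈ N ^ μ`. Items are blocks, labels are vertices within a block, and
each of the `m * m` rounds shows a left and a right block with the adjacency matrix between them as
payoff.

Distinct rounds read disjoint sets of vertex pairs, so the pair chosen in a round is still fresh
given the past: it is an edge with conditional probability at most `p` in the random graph and at
most `q` in the planted one (`EdgeBound.inter_blockHit`). On the random graph the expected score is
therefore at most `p * m²`, and Markov's inequality bounds the probability of exceeding `m² * N ^
(-τ)` (`EdgeBound.real_le_blockScore`).

On the planted graph, a labeling that picks a planted vertex in every block meeting `S` has expected
payoff close to `q * m²` (`le_integral_bestPayoff`), and low regret forces the learner's mean score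
to be close to it as well. The bound on conditional edge probabilities also caps the second moment,
so Chebyshev's inequality keeps the score above half of `q * m²` (`EdgeBound.real_blockScore_le`).

The exponent `μ` must be below that of `k`, so that blocks meet `S`, yet large enough that the
regret `√(2m * L ^ β * m²)` is negligible against `q * m²`; `exists_block_exponent` provides it.
Both `μ` and `τ` are taken rational, so the test compares integers and runs in polynomial time
(`blockTest_polyTime`). Negative `β` is impossible for any learner
(`Learner.not_achievesRegret_of_neg`). The conjecture is then contradicted by splitting `δ` evenly
among the three constants. -/

theorem Polynomial.monotone_eval_nat (q : Polynomial ℕ) : Monotone fun n : ℕ => q.eval n := by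
  intro a b h
  simp only [Polynomial.eval_eq_sum, Polynomial.sum]
  exact Finset.sum_le_sum fun i _ => Nat.mul_le_mul_left _ (Nat.pow_le_pow_left h _)

/-- Basic instructions charge for the tree they read and never enlarge it; only `pair` does, and it
pays for both halves. Hence outputs have polynomial size, which is what lets polynomial time bounds
compose. -/
theorem Prog.Run.size_le {P : Prog} {x y : Data} {t : ℕ} (h : P.Run x t y) :
    x.size ≤ t ∧ y.size ≤ t := by
  induction h with
  | id x => omega
  | nil x => simp only [Data.size]; omega
  | head x => cases x <;> simp only [Data.size, Data.head] <;> omega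
  | tail x => cases x <;> simp only [Data.size, Data.tail] <;> omega
  | pair _ _ h1 h2 => simp only [Data.size]; omega
  | seq _ _ h1 h2 => omega
  | ite_true _ _ h1 h2 => omega
  | ite_false _ _ h1 h2 => omega
  | loop_stop _ h1 => omega
  | loop_step _ _ _ h1 h2 h3 => omega

/-! ### Sizes of encodings and access by iterated tails -/

namespace Data

theorem size_ofNat (n : ℕ) : (ofNat n).size = 2 * n + 1 := by
  induction n with
  | zero => rfl
  | succ n ih => simp only [ofNat, size, ih]; omega

theorem size_ofList_le {l : List Data} {B : ℕ} (h : ∀ d ∈ l, d.size ≤ B) :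
    (ofList (fun d => d) l).size ≤ l.length * (1 + B) + 1 := by
  induction l with
  | nil => simp [ofList, size]
  | cons x l ih =>
    have h1 := ih fun d hd => h d (List.mem_cons_of_mem _ hd)
    have h2 := h x List.mem_cons_self
    simp only [ofList, size, List.length_cons]
    nlinarith

theorem length_lt_size_ofList (l : List Data) : l.length < (ofList (fun d => d) l).size := by
  induction l with
  | nil => simp [ofList, size]
  | cons x l ih => simp only [ofList, size, List.length_cons]; omega

theorem ofList_map {X : Type} (enc : X → Data) (l : List X) :
    ofList enc l = ofList (fun d => d) (l.map enc) := by
  induction l with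
  | nil => rfl
  | cons x l ih => simp [ofList, ih]

theorem tail_iterate_ofNat (a b : ℕ) : tail^[a] (ofNat b) = ofNat (b - a) := by
  induction a generalizing b with
  | zero => rfl
  | succ a ih =>
    rw [Function.iterate_succ_apply]
    cases b with
    | zero => simpa [tail, ofNat] using ih 0
    | succ b => simpa [tail, ofNat] using ih b

theorem tail_iterate_ofList (l : List Data) (j : ℕ) :
    tail^[j] (ofList (fun d => d) l) = ofList (fun d => d) (l.drop j) := by
  induction j generalizing l with
  | zero => rfl
  | succ j ih =>
    rw [Function.iterate_succ_apply]
    cases l with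
    | nil => simpa [ofList, tail] using ih []
    | cons x l => simpa [ofList, tail] using ih l

theorem size_tail_iterate_le (k : ℕ) (d : Data) : (tail^[k] d).size ≤ d.size := by
  induction k generalizing d with
  | zero => exact le_rfl
  | succ k ih =>
    refine (ih d.tail).trans ?_
    cases d <;> simp only [tail, size] <;> omega

theorem head_tail_iterate_ofSeq {m : ℕ} (f : Fin m → Data) (j : ℕ) :
    (tail^[j] (ofSeq f)).head = if h : j < m then f ⟨j, h⟩ else nil := by
  rw [ofSeq, tail_iterate_ofList]
  split_ifs with h
  · rw [List.drop_eq_getElem_cons (by simpa using h)]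
    simp [ofList, head]
  · rw [List.drop_eq_nil_of_le (by simpa using h)]
    rfl

end Data

/-- The values of `f` are bounded by a polynomial in the size of the input. -/
def PolyBounded {ι : Type} (inp : ι → Data) (f : ι → ℕ) : Prop :=
  ∃ q : Polynomial ℕ, ∀ i, f i ≤ q.eval (inp i).size

namespace PolyBounded

variable {ι : Type} {inp : ι → Data} {f g : ι → ℕ}

theorem const (c : ℕ) : PolyBounded inp fun _ => c := ⟨Polynomial.C c, fun i => by simp⟩

theorem size : PolyBounded inp fun i => (inp i).size := ⟨Polynomial.X, fun i => by simp⟩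

theorem add (hf : PolyBounded inp f) (hg : PolyBounded inp g) :
    PolyBounded inp fun i => f i + g i := by
  obtain ⟨p, hp⟩ := hf
  obtain ⟨q, hq⟩ := hg
  exact ⟨p + q, fun i => by simpa using add_le_add (hp i) (hq i)⟩

theorem mul (hf : PolyBounded inp f) (hg : PolyBounded inp g) :
    PolyBounded inp fun i => f i * g i := by
  obtain ⟨p, hp⟩ := hf
  obtain ⟨q, hq⟩ := hg
  exact ⟨p * q, fun i => by simpa using Nat.mul_le_mul (hp i) (hq i)⟩

theorem mono (hg : PolyBounded inp g) (h : ∀ i, f i ≤ g i) : PolyBounded inp f := by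
  obtain ⟨q, hq⟩ := hg
  exact ⟨q, fun i => (h i).trans (hq i)⟩

theorem size_cons_ofNat (hf : PolyBounded inp f) :
    PolyBounded inp fun i => (Data.cons (inp i) (.ofNat (f i))).size := by
  simp only [Data.size, Data.size_ofNat]
  exact ((const 1).add size).add (((const 2).mul hf).add (const 1))

theorem comp {mid : ι → Data} (hf : PolyBounded mid f)
    (hm : PolyBounded inp fun i => (mid i).size) : PolyBounded inp f := by
  obtain ⟨p, hp⟩ := hf
  obtain ⟨q, hq⟩ := hm
  exact ⟨p.comp q, fun i => (hp i).trans <| by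
    rw [Polynomial.eval_comp]; exact p.monotone_eval_nat (hq i)⟩

theorem reindex {κ : Type} (hf : PolyBounded inp f) (φ : κ → ι) :
    PolyBounded (fun i => inp (φ i)) fun i => f (φ i) := by
  obtain ⟨p, hp⟩ := hf
  exact ⟨p, fun i => hp _⟩

end PolyBounded

/-! ### Closure under the program constructors -/

namespace ComputableInPolyTime

variable {ι : Type} {inp : ι → Data}

/-- With `exists_bounded`, this trades explicit polynomials for the predicate `PolyBounded`, so
running times can be added without naming polynomials. -/
theorem of_bounded {out : ι → Data} {f : ι → ℕ} (P : Prog) (hf : PolyBounded inp f)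
    (h : ∀ i, ∃ t ≤ f i, P.Run (inp i) t (out i)) : ComputableInPolyTime inp out := by
  obtain ⟨q, hq⟩ := hf
  refine ⟨P, q, fun i => ?_⟩
  obtain ⟨t, ht, hr⟩ := h i
  exact ⟨t, ht.trans (hq i), hr⟩

theorem exists_bounded {out : ι → Data} (h : ComputableInPolyTime inp out) :
    ∃ (P : Prog) (f : ι → ℕ), PolyBounded inp f ∧ ∀ i, ∃ t ≤ f i, P.Run (inp i) t (out i) := by
  obtain ⟨P, q, h⟩ := h
  exact ⟨P, _, ⟨q, fun i => le_rfl⟩, h⟩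

theorem size_bounded {out : ι → Data} (h : ComputableInPolyTime inp out) :
    PolyBounded inp fun i => (out i).size := by
  obtain ⟨P, q, h⟩ := h
  refine ⟨q, fun i => ?_⟩
  obtain ⟨t, ht, hr⟩ := h i
  exact hr.size_le.2.trans ht

theorem reindex {κ : Type} {out : ι → Data} (h : ComputableInPolyTime inp out) (φ : κ → ι) :
    ComputableInPolyTime (fun i => inp (φ i)) fun i => out (φ i) := by
  obtain ⟨P, q, h⟩ := h
  exact ⟨P, q, fun i => h _⟩

theorem congr {out out' : ι → Data} (h : ComputableInPolyTime inp out) (h' : ∀ i, out i = out' i) :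
    ComputableInPolyTime inp out' := by
  rwa [← funext h']

protected theorem id : ComputableInPolyTime inp inp :=
  of_bounded .id ((PolyBounded.const 1).add .size) fun _ => ⟨_, le_rfl, .id _⟩

protected theorem nil : ComputableInPolyTime inp fun _ => .nil :=
  of_bounded .nil ((PolyBounded.const 1).add .size) fun _ => ⟨_, le_rfl, .nil _⟩

theorem comp {mid out : ι → Data} (h₁ : ComputableInPolyTime inp mid)
    (h₂ : ComputableInPolyTime mid out) : ComputableInPolyTime inp out := by
  have hs := h₁.size_bounded
  obtain ⟨P₁, f₁, hf₁, h₁⟩ := h₁.exists_bounded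
  obtain ⟨P₂, f₂, hf₂, h₂⟩ := h₂.exists_bounded
  refine of_bounded (P₁.seq P₂) (((PolyBounded.const 1).add hf₁).add (hf₂.comp hs)) fun i => ?_
  obtain ⟨s, hs, r₁⟩ := h₁ i
  obtain ⟨t, ht, r₂⟩ := h₂ i
  exact ⟨_, by omega, r₁.seq r₂⟩

theorem cons {x y : ι → Data} (h₁ : ComputableInPolyTime inp x) (h₂ : ComputableInPolyTime inp y) :
    ComputableInPolyTime inp fun i => .cons (x i) (y i) := by
  obtain ⟨P₁, f₁, hf₁, h₁⟩ := h₁.exists_bounded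
  obtain ⟨P₂, f₂, hf₂, h₂⟩ := h₂.exists_bounded
  refine of_bounded (P₁.pair P₂) (((PolyBounded.const 1).add hf₁).add hf₂) fun i => ?_
  obtain ⟨s, hs, r₁⟩ := h₁ i
  obtain ⟨t, ht, r₂⟩ := h₂ i
  exact ⟨_, by omega, r₁.pair r₂⟩

theorem head {x : ι → Data} (h : ComputableInPolyTime inp x) :
    ComputableInPolyTime inp fun i => (x i).head :=
  h.comp <| of_bounded .head ((PolyBounded.const 1).add .size) fun _ => ⟨_, le_rfl, .head _⟩

theorem tail {x : ι → Data} (h : ComputableInPolyTime inp x) :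
    ComputableInPolyTime inp fun i => (x i).tail :=
  h.comp <| of_bounded .tail ((PolyBounded.const 1).add .size) fun _ => ⟨_, le_rfl, .tail _⟩

theorem fst {x y : ι → Data} (h : ComputableInPolyTime inp fun i => .cons (x i) (y i)) :
    ComputableInPolyTime inp x := h.head

theorem snd {x y : ι → Data} (h : ComputableInPolyTime inp fun i => .cons (x i) (y i)) :
    ComputableInPolyTime inp y := h.tail

theorem const (d : Data) : ComputableInPolyTime inp fun _ => d := by
  induction d with
  | nil => exact .nil
  | cons a b iha ihb => exact iha.cons ihb

theorem matchNil {c x y : ι → Data} (hc : ComputableInPolyTime inp c)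
    (h₁ : ComputableInPolyTime inp x) (h₂ : ComputableInPolyTime inp y) :
    ComputableInPolyTime inp fun i => match c i with
      | .nil => y i
      | .cons _ _ => x i := by
  obtain ⟨P, f, hf, hc⟩ := hc.exists_bounded
  obtain ⟨P₁, f₁, hf₁, h₁⟩ := h₁.exists_bounded
  obtain ⟨P₂, f₂, hf₂, h₂⟩ := h₂.exists_bounded
  refine of_bounded (P.ite P₁ P₂) ((((PolyBounded.const 1).add hf).add hf₁).add hf₂) fun i => ?_
  obtain ⟨u, hu, r⟩ := hc i
  obtain ⟨s, hs, r₁⟩ := h₁ i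
  obtain ⟨t, ht, r₂⟩ := h₂ i
  cases hci : c i with
  | nil => rw [hci] at r; exact ⟨1 + u + t, by omega, r.ite_false r₂⟩
  | cons a b => rw [hci] at r; exact ⟨1 + u + s, by omega, r.ite_true r₁⟩

protected theorem ite {c : ι → Bool} {x y : ι → Data}
    (hc : ComputableInPolyTime inp fun i => .ofBool (c i)) (h₁ : ComputableInPolyTime inp x)
    (h₂ : ComputableInPolyTime inp y) :
    ComputableInPolyTime inp fun i => if c i then x i else y i :=
  (hc.matchNil h₁ h₂).congr fun i => by cases c i <;> rfl

theorem ofNat_ne_zero {f : ι → ℕ} (h : ComputableInPolyTime inp fun i => .ofNat (f i)) :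
    ComputableInPolyTime inp fun i => .ofBool (decide (f i ≠ 0)) :=
  (h.matchNil (const (.ofBool true)) (const (.ofBool false))).congr fun i => by
    cases f i <;> rfl

theorem ofNat_eq_zero {f : ι → ℕ} (h : ComputableInPolyTime inp fun i => .ofNat (f i)) :
    ComputableInPolyTime inp fun i => .ofBool (decide (f i = 0)) :=
  (h.matchNil (const (.ofBool false)) (const (.ofBool true))).congr fun i => by
    cases f i <;> rfl

/-! ### Bounded loops -/

/-- A loop that runs through the states `st i (b i), …, st i 0`. -/
theorem countdown {b : ι → ℕ} {st : ι → ℕ → Data}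
    (hs : ComputableInPolyTime inp fun i => st i (b i))
    (hc : ComputableInPolyTime (ι := Σ i, Fin (b i + 1)) (fun p => st p.1 p.2)
      fun p => .ofBool (decide ((p.2 : ℕ) ≠ 0)))
    (hf : ComputableInPolyTime (ι := Σ i, Fin (b i)) (fun p => st p.1 (p.2 + 1))
      fun p => st p.1 p.2)
    (hb : PolyBounded inp b)
    (hsz : PolyBounded (ι := Σ i, Fin (b i + 1)) (fun p => inp p.1) fun p => (st p.1 p.2).size) :
    ComputableInPolyTime inp fun i => st i 0 := by
  obtain ⟨c, qc, hc⟩ := hc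
  obtain ⟨f, qf, hf⟩ := hf
  obtain ⟨qz, hz⟩ := hsz
  obtain ⟨Ps, qs, hs⟩ := hs
  obtain ⟨qb, hb⟩ := hb
  -- The uniform bound `qz` on the intermediate states makes every pass cost a fixed polynomial in
  -- the original input; without it, sizes could compound from pass to pass.
  have key : ∀ i k, k ≤ b i → ∃ t ≤ (k + 1) * (1 + qc.eval (qz.eval (inp i).size)
      + qf.eval (qz.eval (inp i).size)), (Prog.loop c f).Run (st i k) t (st i 0) := by
    intro i k
    induction k with
    | zero =>
      intro hk
      obtain ⟨s, hs, hr⟩ := hc ⟨i, ⟨0, by omega⟩⟩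
      have h1 := qc.monotone_eval_nat (hz ⟨i, ⟨0, by omega⟩⟩)
      simp only at hs hr h1
      have r := Prog.Run.loop_stop (f := f) (by simpa [Data.ofBool] using hr)
      exact ⟨_, by omega, r⟩
    | succ k ih =>
      intro hk
      obtain ⟨u, hu, hl⟩ := ih (by omega)
      obtain ⟨s, hs, hr⟩ := hc ⟨i, ⟨k + 1, by omega⟩⟩
      obtain ⟨t, ht, hr'⟩ := hf ⟨i, ⟨k, by omega⟩⟩
      have h1 := qc.monotone_eval_nat (hz ⟨i, ⟨k + 1, by omega⟩⟩)
      have h2 := qf.monotone_eval_nat (hz ⟨i, ⟨k + 1, by omega⟩⟩)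
      simp only at hs hr h1 ht hr' h2
      refine ⟨_, ?_, .loop_step (by simpa [Data.ofBool] using hr) hr' hl⟩
      rw [add_mul (k + 1) 1, one_mul]
      omega
  refine ⟨Ps.seq (.loop c f), 1 + qs + (qb + 1) * (1 + qc.comp qz + qf.comp qz), fun i => ?_⟩
  obtain ⟨s, hs, r₁⟩ := hs i
  obtain ⟨t, ht, r₂⟩ := key i (b i) le_rfl
  refine ⟨_, ?_, r₁.seq r₂⟩
  have h1 := Nat.mul_le_mul_right (1 + qc.eval (qz.eval (inp i).size)
      + qf.eval (qz.eval (inp i).size)) (Nat.succ_le_succ (hb i))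
  simp only [Polynomial.eval_add, Polynomial.eval_one, Polynomial.eval_mul, Polynomial.eval_comp]
  simp only [Nat.succ_eq_add_one] at h1
  omega

theorem polyBounded_of_ofNat {f : ι → ℕ} (h : ComputableInPolyTime inp fun i => .ofNat (f i)) :
    PolyBounded inp f :=
  h.size_bounded.mono fun i => by rw [Data.size_ofNat]; omega

/-- A loop with a counter that runs down from `b i` to `0` and an accumulator. -/
theorem foldRange {b : ι → ℕ} {acc : ι → ℕ → Data}
    (hb : ComputableInPolyTime inp fun i => .ofNat (b i))
    (h0 : ComputableInPolyTime inp fun i => acc i (b i))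
    (hf : ComputableInPolyTime (ι := Σ i, Fin (b i))
      (fun p => .cons (inp p.1) (.cons (.ofNat p.2) (acc p.1 (p.2 + 1)))) fun p => acc p.1 p.2)
    (hsz : PolyBounded (ι := Σ i, Fin (b i + 1)) (fun p => inp p.1) fun p => (acc p.1 p.2).size) :
    ComputableInPolyTime inp fun i => acc i 0 := by
  refine (countdown (b := b) (st := fun i k => .cons (inp i) (.cons (.ofNat k) (acc i k)))
    (.cons .id (.cons hb h0)) ?_ ?_ hb.polyBounded_of_ofNat ?_).snd.snd
  · exact ComputableInPolyTime.id.snd.fst.ofNat_ne_zero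
  · have h1 : ComputableInPolyTime (ι := Σ i, Fin (b i))
        (fun p => .cons (inp p.1) (.cons (.ofNat (p.2 + 1)) (acc p.1 (p.2 + 1))))
        fun p => .cons (inp p.1) (.cons (.ofNat p.2) (acc p.1 (p.2 + 1))) :=
      .cons ComputableInPolyTime.id.fst (.cons ComputableInPolyTime.id.snd.fst.tail
        ComputableInPolyTime.id.snd.snd)
    exact .cons h1.fst (.cons h1.snd.fst (h1.comp hf))
  · simp only [Data.size, Data.size_ofNat]
    have h1 : PolyBounded (ι := Σ i, Fin (b i + 1)) (fun p => inp p.1) fun p => (p.2 : ℕ) :=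
      (hb.polyBounded_of_ofNat.reindex fun p : Σ i, Fin (b i + 1) => p.1).mono fun p => by
        have := p.2.2; omega
    exact ((PolyBounded.const 1).add .size).add
      (((PolyBounded.const 1).add (((PolyBounded.const 2).mul h1).add (.const 1))).add hsz)

/-! ### Unary arithmetic, lists and sums -/

theorem tail_iterate {f : ι → ℕ} {d : ι → Data}
    (hf : ComputableInPolyTime inp fun i => .ofNat (f i)) (hd : ComputableInPolyTime inp d) :
    ComputableInPolyTime inp fun i => Data.tail^[f i] (d i) := by
  refine foldRange (acc := fun i k => Data.tail^[f i - k] (d i)) hf (by simpa using hd) ?_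
    ((hd.size_bounded.reindex fun p : Σ i, Fin (f i + 1) => p.1).mono fun p => Data.size_tail_iterate_le _ _)
  refine ComputableInPolyTime.id.snd.snd.tail.congr fun p => ?_
  have := p.2.2
  rw [← Function.iterate_succ_apply' Data.tail, show f p.1 - (p.2 : ℕ) = f p.1 - (p.2 + 1) + 1 by omega]

theorem succ {f : ι → ℕ} (hf : ComputableInPolyTime inp fun i => .ofNat (f i)) :
    ComputableInPolyTime inp fun i => .ofNat (f i + 1) :=
  .cons .nil hf

theorem add {f g : ι → ℕ} (hf : ComputableInPolyTime inp fun i => .ofNat (f i))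
    (hg : ComputableInPolyTime inp fun i => .ofNat (g i)) :
    ComputableInPolyTime inp fun i => .ofNat (f i + g i) := by
  refine (foldRange (acc := fun i k => .ofNat (f i - k + g i)) hf (by simpa using hg) ?_ ?_).congr
    fun i => by simp
  · refine (ComputableInPolyTime.id.snd.snd.succ).congr fun p => ?_
    have := p.2.2
    congr 1
    omega
  · simp only [Data.size_ofNat]
    refine ((((PolyBounded.const 2).mul (hf.polyBounded_of_ofNat.add
      hg.polyBounded_of_ofNat)).add (.const 1)).reindex
      fun p : Σ i, Fin (f i + 1) => p.1).mono fun p => by omega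

theorem sub {f g : ι → ℕ} (hf : ComputableInPolyTime inp fun i => .ofNat (f i))
    (hg : ComputableInPolyTime inp fun i => .ofNat (g i)) :
    ComputableInPolyTime inp fun i => .ofNat (f i - g i) :=
  (hg.tail_iterate hf).congr fun _ => Data.tail_iterate_ofNat _ _

protected theorem le {f g : ι → ℕ} (hf : ComputableInPolyTime inp fun i => .ofNat (f i))
    (hg : ComputableInPolyTime inp fun i => .ofNat (g i)) :
    ComputableInPolyTime inp fun i => .ofBool (decide (f i ≤ g i)) :=
  (hf.sub hg).ofNat_eq_zero.congr fun i => by simp only [Nat.sub_eq_zero_iff_le]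

/-- The value of a computable function at each member of a computable range, as a list. -/
theorem ofSeq {b : ι → ℕ} {g : ∀ i, Fin (b i) → Data}
    (hb : ComputableInPolyTime inp fun i => .ofNat (b i))
    (hg : ComputableInPolyTime (ι := Σ i, Fin (b i)) (fun p => .cons (inp p.1) (.ofNat p.2))
      fun p => g p.1 p.2) :
    ComputableInPolyTime inp fun i => .ofSeq (g i) := by
  have hbd : PolyBounded (ι := Σ i, Fin (b i)) (fun p => inp p.1) fun p => (g p.1 p.2).size := by
    refine hg.size_bounded.comp ?_
    have h1 : PolyBounded (ι := Σ i, Fin (b i)) (fun p => inp p.1) fun p => (p.2 : ℕ) :=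
      (hb.polyBounded_of_ofNat.reindex fun p : Σ i, Fin (b i) => p.1).mono fun p => p.2.2.le
    exact h1.size_cons_ofNat
  -- The counter runs downward, so the list is built from its end: the accumulator at `k` is the
  -- part from index `k` on, and each pass only has to prepend one entry.
  refine foldRange (acc := fun i k => .ofList (fun d => d) ((List.ofFn (g i)).drop k)) hb
    (ComputableInPolyTime.nil.congr fun i => ?_) ?_ ?_
  · rw [List.drop_eq_nil_of_le (by simp)]
    rfl
  · have h1 : ComputableInPolyTime (ι := Σ i, Fin (b i))
        (fun p => .cons (inp p.1) (.cons (.ofNat p.2)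
          (.ofList (fun d => d) ((List.ofFn (g p.1)).drop (p.2 + 1)))))
        fun p => .cons (inp p.1) (.ofNat p.2) :=
      .cons ComputableInPolyTime.id.fst ComputableInPolyTime.id.snd.fst
    refine ((h1.comp hg).cons ComputableInPolyTime.id.snd.snd).congr fun p => ?_
    rw [List.drop_eq_getElem_cons (by simp : (p.2 : ℕ) < (List.ofFn (g p.1)).length)]
    simp [Data.ofList]
  · obtain ⟨q, hq⟩ := hbd
    refine (((hb.polyBounded_of_ofNat.mul ((PolyBounded.const 1).add ⟨q, fun _ => le_rfl⟩)).add
      (.const 1)).reindex fun p : Σ i, Fin (b i + 1) => p.1).mono fun p => ?_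
    refine (Data.size_ofList_le (B := q.eval (inp p.1).size) fun d hd => ?_).trans ?_
    · obtain ⟨j, rfl⟩ := List.mem_ofFn.1 (List.mem_of_mem_drop hd)
      exact hq ⟨p.1, j⟩
    · gcongr
      rw [List.length_drop, List.length_ofFn]; omega

theorem sum {b : ι → ℕ} {g : ∀ i, Fin (b i) → ℕ}
    (hb : ComputableInPolyTime inp fun i => .ofNat (b i))
    (hg : ComputableInPolyTime (ι := Σ i, Fin (b i)) (fun p => .cons (inp p.1) (.ofNat p.2))
      fun p => .ofNat (g p.1 p.2)) :
    ComputableInPolyTime inp fun i => .ofNat (∑ j, g i j) := by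
  have hbd : PolyBounded (ι := Σ i, Fin (b i)) (fun p => inp p.1) fun p => g p.1 p.2 := by
    refine hg.polyBounded_of_ofNat.comp ?_
    have h1 : PolyBounded (ι := Σ i, Fin (b i)) (fun p => inp p.1) fun p => (p.2 : ℕ) :=
      (hb.polyBounded_of_ofNat.reindex fun p : Σ i, Fin (b i) => p.1).mono fun p => p.2.2.le
    exact h1.size_cons_ofNat
  refine (foldRange (acc := fun i k => .ofNat ((List.ofFn (g i)).drop k).sum) hb
    (ComputableInPolyTime.nil.congr fun i => ?_) ?_ ?_).congr fun i => ?_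
  · rw [List.drop_eq_nil_of_le (by simp)]
    rfl
  · have h1 : ComputableInPolyTime (ι := Σ i, Fin (b i))
        (fun p => .cons (inp p.1) (.cons (.ofNat p.2)
          (.ofNat ((List.ofFn (g p.1)).drop (p.2 + 1)).sum)))
        fun p => .cons (inp p.1) (.ofNat p.2) :=
      .cons ComputableInPolyTime.id.fst ComputableInPolyTime.id.snd.fst
    refine ((h1.comp hg).add ComputableInPolyTime.id.snd.snd).congr fun p => ?_
    rw [List.drop_eq_getElem_cons (by simp : (p.2 : ℕ) < (List.ofFn (g p.1)).length)]
    simp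
  · obtain ⟨q, hq⟩ := hbd
    simp only [Data.size_ofNat]
    refine ((((PolyBounded.const 2).mul (hb.polyBounded_of_ofNat.mul ⟨q, fun _ => le_rfl⟩)).add
      (.const 1)).reindex fun p : Σ i, Fin (b i + 1) => p.1).mono fun p => ?_
    have h2 := List.sum_le_card_nsmul ((List.ofFn (g p.1)).drop p.2) (q.eval (inp p.1).size)
      fun d hd => by
        obtain ⟨j, rfl⟩ := List.mem_ofFn.1 (List.mem_of_mem_drop hd)
        exact hq ⟨p.1, j⟩
    have h3 : ((List.ofFn (g p.1)).drop p.2).length ≤ b p.1 := by simp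
    rw [smul_eq_mul] at h2
    have := h2.trans (Nat.mul_le_mul_right _ h3)
    omega
  · simp [List.sum_ofFn]

/-- Together with `var`, this treats the input as an environment: the body of a bounded loop sees
the outer input paired with the loop index, and nested loops extend the environment repeatedly. -/
theorem weaken {out : ι → Data} (h : ComputableInPolyTime inp out) {b : ι → ℕ} :
    ComputableInPolyTime (ι := Σ i, Fin (b i)) (fun p => .cons (inp p.1) (.ofNat p.2))
      fun p => out p.1 :=
  (ComputableInPolyTime.id.fst).comp (h.reindex fun p : Σ i, Fin (b i) => p.1)

theorem var {b : ι → ℕ} :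
    ComputableInPolyTime (ι := Σ i, Fin (b i)) (fun p => .cons (inp p.1) (.ofNat p.2))
      fun p => .ofNat p.2 :=
  ComputableInPolyTime.id.snd

theorem mul {f g : ι → ℕ} (hf : ComputableInPolyTime inp fun i => .ofNat (f i))
    (hg : ComputableInPolyTime inp fun i => .ofNat (g i)) :
    ComputableInPolyTime inp fun i => .ofNat (f i * g i) :=
  (hf.sum (g := fun i _ => g i) hg.weaken).congr fun i => by simp

theorem pow {f : ι → ℕ} (hf : ComputableInPolyTime inp fun i => .ofNat (f i)) (k : ℕ) :
    ComputableInPolyTime inp fun i => .ofNat (f i ^ k) := by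
  induction k with
  | zero => exact (const (.ofNat 1)).congr fun i => by simp
  | succ k ih => exact (ih.mul hf).congr fun i => by rw [pow_succ]

theorem polynomial_eval {f : ι → ℕ} (hf : ComputableInPolyTime inp fun i => .ofNat (f i))
    (q : Polynomial ℕ) : ComputableInPolyTime inp fun i => .ofNat (q.eval (f i)) := by
  induction q using Polynomial.induction_on' with
  | add p q hp hq => exact (hp.add hq).congr fun i => by simp
  | monomial k c =>
    exact ((const (.ofNat c)).mul (hf.pow k)).congr fun i => by simp [Polynomial.eval_monomial]

theorem card_filter {b : ι → ℕ} {g : ∀ i, Fin (b i) → Bool}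
    (hb : ComputableInPolyTime inp fun i => .ofNat (b i))
    (hg : ComputableInPolyTime (ι := Σ i, Fin (b i)) (fun p => .cons (inp p.1) (.ofNat p.2))
      fun p => .ofBool (g p.1 p.2)) :
    ComputableInPolyTime inp fun i => .ofNat (∑ j, if g i j then 1 else 0) :=
  hb.sum ((hg.ite (const (.ofNat 1)) (const (.ofNat 0))).congr fun p => by split_ifs <;> rfl)

theorem lookup {m : ι → ℕ} {f : ∀ i, Fin (m i) → Data} {j : ι → ℕ}
    (hf : ComputableInPolyTime inp fun i => .ofSeq (f i))
    (hj : ComputableInPolyTime inp fun i => .ofNat (j i)) :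
    ComputableInPolyTime inp fun i => if h : j i < m i then f i ⟨j i, h⟩ else .nil :=
  (hj.tail_iterate hf).head.congr fun _ => Data.head_tail_iterate_ofSeq _ _

/-- The number of vertices is not part of the input and must be read off the adjacency matrix. Here
`foldRange` would be circular, since it needs the number of passes to be computed in advance;
`countdown` needs only a bound for it, and the loop stops when the list is exhausted. -/
theorem length {m : ι → ℕ} {f : ∀ i, Fin (m i) → Data}
    (hf : ComputableInPolyTime inp fun i => .ofSeq (f i)) :
    ComputableInPolyTime inp fun i => .ofNat (m i) := by
  have hm : PolyBounded inp m := hf.size_bounded.mono fun i => by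
    have := Data.length_lt_size_ofList (List.ofFn (f i))
    rw [List.length_ofFn] at this
    exact this.le
  have hst : ∀ i k, ∀ hk : k < m i, Data.tail^[m i - (k + 1)] (.ofSeq (f i)) =
      .cons (f i ⟨m i - (k + 1), by omega⟩) (Data.tail^[m i - k] (.ofSeq (f i))) := by
    intro i k hk
    rw [show m i - k = m i - (k + 1) + 1 by omega, Function.iterate_succ_apply',
      Data.ofSeq, Data.tail_iterate_ofList, List.drop_eq_getElem_cons (show m i - (k + 1) <
        (List.ofFn (f i)).length by rw [List.length_ofFn]; omega)]
    simp [Data.ofList, Data.tail]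
  have hnil : ∀ i, Data.tail^[m i] (.ofSeq (f i)) = .nil := by
    intro i
    rw [Data.ofSeq, Data.tail_iterate_ofList, List.drop_eq_nil_of_le (by simp)]
    rfl
  refine (countdown (b := m) (st := fun i k => .cons (Data.tail^[m i - k] (.ofSeq (f i)))
    (.ofNat (m i - k))) ?_ ?_ ?_ hm ?_).snd
  · exact (hf.cons .nil).congr fun i => by simp [Data.ofNat]
  · refine (ComputableInPolyTime.id.fst.matchNil (const (.ofBool true))
      (const (.ofBool false))).congr fun p => ?_
    obtain ⟨i, k, hk⟩ := p
    cases k with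
    | zero => simp [hnil]
    | succ k => 
      change (match Data.tail^[m i - (k + 1)] (.ofSeq (f i)) with
        | .nil => Data.ofBool false
        | .cons _ _ => Data.ofBool true) = _
      rw [hst i k (by omega)]
      rfl
  · refine (ComputableInPolyTime.id.fst.tail.cons ComputableInPolyTime.id.snd.succ).congr
      fun p => ?_
    have := p.2.2
    rw [hst p.1 p.2 this, show m p.1 - ((p.2 : ℕ) + 1) + 1 = m p.1 - p.2 by omega]
    rfl
  · simp only [Data.size, Data.size_ofNat]
    refine ((((PolyBounded.const 1).add hf.size_bounded).add
      (((PolyBounded.const 2).mul hm).add (.const 1))).reindex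
      fun p : Σ i, Fin (m i + 1) => p.1).mono fun p => ?_
    have := Data.size_tail_iterate_le (m p.1 - p.2) (.ofSeq (f p.1))
    gcongr
    omega

/-- The quotient is the number of `j < f` with `(j + 1) * g ≤ f`. -/
theorem div {f g : ι → ℕ} (hf : ComputableInPolyTime inp fun i => .ofNat (f i))
    (hg : ComputableInPolyTime inp fun i => .ofNat (g i)) (h0 : ∀ i, 0 < g i) :
    ComputableInPolyTime inp fun i => .ofNat (f i / g i) := by
  refine (hf.card_filter (g := fun i j => decide ((j + 1) * g i ≤ f i))
    ((var.succ.mul hg.weaken).le hf.weaken)).congr fun i => ?_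
  congr 1
  have h1 : ∀ j : Fin (f i), decide ((j + 1) * g i ≤ f i) = true ↔ (j : ℕ) < f i / g i := fun j => by
    rw [decide_eq_true_iff, ← Nat.le_div_iff_mul_le (h0 i), Nat.succ_le_iff]
  simp only [h1]
  rw [Fin.sum_univ_eq_sum_range (fun j => if j < f i / g i then 1 else 0)]
  simp only [Finset.sum_boole, Nat.cast_id]
  have : (Finset.range (f i)).filter (fun j => j < f i / g i) = Finset.range (f i / g i) := by
    ext j
    have := Nat.div_le_self (f i) (g i)
    simp only [Finset.mem_filter, Finset.mem_range]
    omega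
  rw [this, Finset.card_range]

theorem mod {f g : ι → ℕ} (hf : ComputableInPolyTime inp fun i => .ofNat (f i))
    (hg : ComputableInPolyTime inp fun i => .ofNat (g i)) (h0 : ∀ i, 0 < g i) :
    ComputableInPolyTime inp fun i => .ofNat (f i % g i) :=
  (hf.sub (hg.mul (hf.div hg h0))).congr fun i => by rw [Nat.mod_eq_sub_mul_div]

end ComputableInPolyTime

/-! ## The game played on the blocks of a graph -/

/-- Adjacency of vertices given by their indices; there are no edges outside the vertex set. -/
def edgeAt {N : ℕ} (G : SimpleGraph (Fin N)) (u v : ℕ) : Prop :=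
  ∃ (hu : u < N) (hv : v < N), G.Adj ⟨u, hu⟩ ⟨v, hv⟩

/-- `⌊N ^ (a / b)⌋ + 1`, when `a < b`. -/
def blockCount (a b N : ℕ) : ℕ+ :=
  ⟨(∑ j : Fin N, if decide (((j : ℕ) + 1) ^ b ≤ N ^ a) then 1 else 0) + 1, Nat.succ_pos _⟩

/-- The size of each of `2 * m` blocks in a set of `N` elements. -/
def blockSize (m N : ℕ) : ℕ+ := ⟨N / (2 * m) - 1 + 1, Nat.succ_pos _⟩

open Classical in
/-- Round `t` of the game on the graph `G` with `2 * m` blocks of `L` vertices: one block of the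
first half, one of the second half, and the adjacency matrix between them as payoff function. -/
noncomputable def blockRound {N : ℕ} (G : SimpleGraph (Fin N)) (m L : ℕ+)
    (t : Fin (m * m : ℕ+)) : Round (2 * m : ℕ+) L where
  i := ⟨t / m, by
    have h : (t : ℕ) < m * m := t.2
    have := Nat.div_lt_of_lt_mul h
    change (t : ℕ) / m < 2 * (m : ℕ)
    omega⟩
  j := ⟨m + t % m, by
    have := Nat.mod_lt (t : ℕ) m.pos
    change (m : ℕ) + t % m < 2 * m
    omega⟩
  payoff a b := if edgeAt G (t / m * L + a) ((m + t % m) * L + b) then 1 else 0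
  abs_payoff_le a b := by split_ifs <;> simp

/-- The labels that the learner chooses in round `t` of the game on `G`. -/
noncomputable def blockLabel (A : Learner) {N : ℕ} (G : SimpleGraph (Fin N)) (m L : ℕ+)
    (r : Fin (A.coins.eval ((2 * m : ℕ+) + L + (m * m : ℕ+) : ℕ)) → Bool)
    (t : Fin (m * m : ℕ+)) : Fin L × Fin L :=
  A.label (2 * m) L (m * m) r (viewAt (blockRound G m L) t)

/-- The learner's labels in round `t` form an edge. -/
def blockHit (A : Learner) {N : ℕ} (G : SimpleGraph (Fin N)) (m L : ℕ+)
    (r : Fin (A.coins.eval ((2 * m : ℕ+) + L + (m * m : ℕ+) : ℕ)) → Bool)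
    (t : Fin (m * m : ℕ+)) : Prop :=
  edgeAt G (t / m * L + (blockLabel A G m L r t).1) ((m + t % m) * L + (blockLabel A G m L r t).2)

open Classical in
/-- The learner's total payoff in the game on `G`. -/
noncomputable def blockScore (A : Learner) {N : ℕ} (G : SimpleGraph (Fin N)) (m L : ℕ+)
    (r : Fin (A.coins.eval ((2 * m : ℕ+) + L + (m * m : ℕ+) : ℕ)) → Bool) : ℕ :=
  ∑ t, if decide (blockHit A G m L r t) then 1 else 0

theorem blockCount_le (a b N : ℕ) : (blockCount a b N : ℕ) ≤ N + 1 := by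
  rw [blockCount, PNat.mk_coe, Finset.sum_boole]
  have := Finset.card_filter_le (Finset.univ : Finset (Fin N))
    fun j => decide (((j : ℕ) + 1) ^ b ≤ N ^ a) = true
  rw [Finset.card_univ, Fintype.card_fin] at this
  exact Nat.succ_le_succ this

theorem blockSize_le (m N : ℕ) : (blockSize m N : ℕ) ≤ N + 1 := by
  rw [blockSize, PNat.mk_coe]
  have := Nat.div_le_self N (2 * m)
  omega

/-- The number of coins that suffice for the game on a graph with a given number of vertices. -/
noncomputable def blockCoins (A : Learner) : Polynomial ℕ :=
  A.coins.comp (2 * (Polynomial.X + 1) + (Polynomial.X + 1) +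
    (Polynomial.X + 1) * (Polynomial.X + 1))

/-- A distinguisher's number of coins is a polynomial in `N` alone, so crude bounds on `m` and `L`
are inserted; the surplus coins are ignored. -/
theorem coins_le_blockCoins (A : Learner) (a b N : ℕ) :
    A.coins.eval ((2 * blockCount a b N : ℕ+) + blockSize (blockCount a b N) N +
      (blockCount a b N * blockCount a b N : ℕ+) : ℕ) ≤ (blockCoins A).eval N := by
  rw [blockCoins, Polynomial.eval_comp]
  refine A.coins.monotone_eval_nat ?_
  have h1 := blockCount_le a b N
  have h2 := blockSize_le (blockCount a b N) N
  simp only [Polynomial.eval_add, Polynomial.eval_mul, Polynomial.eval_X, Polynomial.eval_one,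
    Polynomial.eval_ofNat, PNat.mul_coe, PNat.val_ofNat]
  gcongr

open Classical in
/-- The test whether the learner's average payoff exceeds `N ^ (-c / d)`, in the game with about
`N ^ (a / b)` blocks. -/
noncomputable def blockTest (A : Learner) (a b c d : ℕ) : Distinguisher where
  coins := blockCoins A
  answer N r G := decide ((blockCount a b N * blockCount a b N : ℕ) ^ d + 1 ≤
    blockScore A G (blockCount a b N) (blockSize (blockCount a b N) N)
      (fun s => r (Fin.castLE (coins_le_blockCoins A a b N) s)) ^ d * N ^ c)

theorem View.toData_viewAt {n L T : ℕ} (x : Fin T → Round n L) (t : Fin T) :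
    (viewAt x t).toData = .cons (.ofSeq fun s : Fin t => (x (Fin.castLE t.2.le s)).toData)
      (.cons (.ofNat (x t).i) (.ofNat (x t).j)) := by
  rw [View.toData, viewAt, Data.ofList_map, Data.ofSeq]
  congr 2
  refine List.ext_getElem (by simp [t.2.le]) fun i h1 h2 => ?_
  simp

/-! ### The game is computable from the graph -/

namespace ComputableInPolyTime

variable {ι : Type} {inp : ι → Data} {N : ι → ℕ} {G : ∀ i, SimpleGraph (Fin (N i))} {m L : ι → ℕ+}

-- Lookups beyond the end of a list return `nil`, which encodes `false`; this agrees with the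
-- convention that there are no edges outside the vertex set.
open Classical in
theorem edgeAt {u v : ι → ℕ} (hG : ComputableInPolyTime inp fun i => .ofGraph (G i))
    (hu : ComputableInPolyTime inp fun i => .ofNat (u i))
    (hv : ComputableInPolyTime inp fun i => .ofNat (v i)) :
    ComputableInPolyTime inp fun i => .ofBool (decide (edgeAt (G i) (u i) (v i))) := by
  refine (hv.tail_iterate (lookup hG hu)).head.congr fun i => ?_
  by_cases h : u i < N i
  · rw [dif_pos h, Data.head_tail_iterate_ofSeq]
    by_cases h' : v i < N i <;> simp [_root_.edgeAt, h, h', Data.ofBool]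
  · rw [dif_neg h, Function.iterate_fixed rfl]
    simp [_root_.edgeAt, h, Data.ofBool, Data.head]

theorem roundToData {t : ∀ i, Fin (m i * m i : ℕ+)}
    (hG : ComputableInPolyTime inp fun i => .ofGraph (G i))
    (hm : ComputableInPolyTime inp fun i => .ofNat (m i))
    (hL : ComputableInPolyTime inp fun i => .ofNat (L i))
    (ht : ComputableInPolyTime inp fun i => .ofNat (t i)) :
    ComputableInPolyTime inp fun i => (blockRound (G i) (m i) (L i) (t i)).toData := by
  have hi := ht.div hm fun i => (m i).2
  have hj := hm.add (ht.mod hm fun i => (m i).2)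
  refine hi.cons (hj.cons (hL.ofSeq (ofSeq hL.weaken ?_)))
  have he := edgeAt hG.weaken.weaken (((hi.mul hL).weaken.add (var (b := fun i => L i))).weaken)
    ((hj.mul hL).weaken.weaken.add (var
      (inp := fun p : Σ i, Fin (L i) => .cons (inp p.1) (.ofNat p.2)) (b := fun p => L p.1)))
  classical
  refine (he.ite (const (.ofRat 1)) (const (.ofRat 0))).congr fun p => ?_
  simp only [blockRound, decide_eq_true_eq]
  split_ifs <;> rfl

theorem viewToData {t : ∀ i, Fin (m i * m i : ℕ+)}
    (hG : ComputableInPolyTime inp fun i => .ofGraph (G i))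
    (hm : ComputableInPolyTime inp fun i => .ofNat (m i))
    (hL : ComputableInPolyTime inp fun i => .ofNat (L i))
    (ht : ComputableInPolyTime inp fun i => .ofNat (t i)) :
    ComputableInPolyTime inp fun i => (viewAt (blockRound (G i) (m i) (L i)) (t i)).toData := by
  simp only [View.toData_viewAt]
  refine (ht.ofSeq ?_).cons
    ((ht.div hm fun i => (m i).2).cons (hm.add (ht.mod hm fun i => (m i).2)))
  exact roundToData (t := fun p : Σ i, Fin (t i) => Fin.castLE (t p.1).2.le p.2)
    hG.weaken hm.weaken hL.weaken var

end ComputableInPolyTime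

/-- The rounds depend on the graph and not on the learner's answers. Every view can thus be rebuilt
from the graph, and the score is a sum of independently computable terms, with no state carried from
round to round. -/
theorem blockTest_polyTime {A : Learner} (hA : A.PolyTime) (a b c d : ℕ) :
    (blockTest A a b c d).PolyTime := by
  let κ := (n : ℕ) × (Fin ((blockCoins A).eval n) → Bool) × SimpleGraph (Fin n)
  let inp : κ → Data := fun i => .cons (.ofSeq fun s => .ofBool (i.2.1 s)) (.ofGraph i.2.2)
  let m : κ → ℕ+ := fun i => blockCount a b i.1
  let L : κ → ℕ+ := fun i => blockSize (m i) i.1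
  let r : ∀ i : κ, Fin (A.coins.eval ((2 * m i : ℕ+) + L i + (m i * m i : ℕ+) : ℕ)) → Bool :=
    fun i s => i.2.1 (Fin.castLE (coins_le_blockCoins A a b i.1) s)
  have hr : ComputableInPolyTime inp fun i => .ofSeq fun s => .ofBool (i.2.1 s) :=
    ComputableInPolyTime.id.fst
  have hG : ComputableInPolyTime inp fun i => .ofGraph i.2.2 := ComputableInPolyTime.id.snd
  have hN : ComputableInPolyTime inp fun i => .ofNat i.1 := hG.length
  have hm : ComputableInPolyTime inp fun i => .ofNat (m i) :=
    (hN.card_filter (.le (.pow (.succ .var) b) (hN.pow a).weaken)).succ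
  have hL : ComputableInPolyTime inp fun i => .ofNat (L i) :=
    ((hN.div ((ComputableInPolyTime.const (.ofNat 2)).mul hm)
      fun i => Nat.mul_pos two_pos (m i).2).sub (.const (.ofNat 1))).succ
  have h2m : ComputableInPolyTime inp fun i => .ofNat (2 * m i : ℕ+) :=
    (ComputableInPolyTime.const (.ofNat 2)).mul hm
  have hT : ComputableInPolyTime inp fun i => .ofNat (m i * m i : ℕ+) := hm.mul hm
  have hc : ComputableInPolyTime inp fun i => .ofSeq fun s => .ofBool (r i s) := by
    refine (((h2m.add hL).add hT).polynomial_eval A.coins).ofSeq ?_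
    -- The learner gets an initial segment of the coins, so the default of `lookup` never occurs.
    refine (ComputableInPolyTime.lookup hr.weaken .var).congr fun p => ?_
    exact dif_pos (p.2.2.trans_le (coins_le_blockCoins A a b p.1.1))
  have hlab : ComputableInPolyTime (ι := Σ i : κ, Fin (m i * m i : ℕ+))
      (fun p => .cons (inp p.1) (.ofNat p.2))
      fun p => .cons (.ofNat (blockLabel A p.1.2.2 (m p.1) (L p.1) (r p.1) p.2).1)
        (.ofNat (blockLabel A p.1.2.2 (m p.1) (L p.1) (r p.1) p.2).2) := by
    refine (h2m.weaken.cons (hL.weaken.cons (hT.weaken.cons (hc.weaken.cons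
      (ComputableInPolyTime.viewToData (t := fun p : Σ i : κ, Fin (m i * m i : ℕ+) => p.2)
        hG.weaken hm.weaken hL.weaken .var))))).comp ?_
    exact ComputableInPolyTime.reindex hA fun p : Σ i : κ, Fin (m i * m i : ℕ+) =>
      ⟨2 * m p.1, L p.1, m p.1 * m p.1, r p.1, viewAt (blockRound p.1.2.2 (m p.1) (L p.1)) p.2⟩
  have hscore : ComputableInPolyTime inp fun i =>
      .ofNat (blockScore A i.2.2 (m i) (L i) (r i)) := by
    refine hT.card_filter (hG.weaken.edgeAt ?_ ?_)
    · exact ((ComputableInPolyTime.var.div hm.weaken fun p => (m p.1).2).mul hL.weaken).add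
        hlab.fst
    · exact ((hm.weaken.add (ComputableInPolyTime.var.mod hm.weaken fun p => (m p.1).2)).mul
        hL.weaken).add hlab.snd
  exact ((hm.mul hm).pow d).succ.le ((hscore.pow d).mul (hN.pow c))

/-! ## Random graphs: independence of a single edge -/

instance {V : Type*} [Countable V] : MeasurableSingletonClass (SimpleGraph V) where
  measurableSet_singleton G := by
    have : ({G} : Set (SimpleGraph V)) = SimpleGraph.edgeSet ⁻¹' {G.edgeSet} := by
      ext H; simp
    rw [this]
    exact SimpleGraph.measurable_edgeSet (measurableSet_singleton _)

instance (n : ℕ) (p : ℝ) : IsProbabilityMeasure (randomGraph n p) := by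
  unfold randomGraph; infer_instance

theorem coe_toProb {p : ℝ} (h0 : 0 ≤ p) (h1 : p ≤ 1) : (toProb p : ℝ) = p := by
  rw [toProb, Set.projIcc_of_mem _ ⟨h0, h1⟩]

theorem randomGraph_real_singleton {n : ℕ} {p : ℝ} (h0 : 0 ≤ p) (h1 : p ≤ 1)
    (G : SimpleGraph (Fin n)) : (randomGraph n p).real {G} =
      p ^ G.edgeSet.ncard * (1 - p) ^ (n.choose 2 - G.edgeSet.ncard) := by
  rw [randomGraph, measureReal_def, SimpleGraph.binomialRandom_singleton]
  simp [coe_toProb h0 h1]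

/-- Membership in `A` does not depend on whether `u` and `v` are adjacent. -/
def EdgeFree {n : ℕ} (u v : Fin n) (A : Set (SimpleGraph (Fin n))) : Prop :=
  ∀ G H : SimpleGraph (Fin n), (∀ x y, s(x, y) ≠ s(u, v) → (G.Adj x y ↔ H.Adj x y)) →
    (G ∈ A ↔ H ∈ A)

/-- Deleting one edge trades one factor `p` of the weight for a factor `1 - p`. -/
theorem randomGraph_real_deleteEdges {n : ℕ} {p : ℝ} (h0 : 0 ≤ p) (h1 : p ≤ 1)
    {G : SimpleGraph (Fin n)} {u v : Fin n} (h : G.Adj u v) :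
    (1 - p) * (randomGraph n p).real {G} = p * (randomGraph n p).real {G.deleteEdges {s(u, v)}} := by
  classical
  rw [randomGraph_real_singleton h0 h1, randomGraph_real_singleton h0 h1,
    SimpleGraph.edgeSet_deleteEdges, Set.ncard_sdiff_singleton_of_mem (by simpa using h)]
  have h2 : 0 < G.edgeSet.ncard := (Set.ncard_pos).2 ⟨s(u, v), by simpa using h⟩
  have h3 : G.edgeSet.ncard ≤ n.choose 2 := by
    have := G.card_edgeFinset_le_card_choose_two
    rwa [Fintype.card_fin, SimpleGraph.edgeFinset, ← Set.ncard_eq_toFinset_card'] at this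
  obtain ⟨k, hk⟩ : ∃ k, G.edgeSet.ncard = k + 1 := ⟨_, (Nat.succ_pred_eq_of_pos h2).symm⟩
  rw [hk, Nat.add_sub_cancel, show n.choose 2 - k = n.choose 2 - (k + 1) + 1 by omega]
  ring

/-- Deleting and inserting the edge `uv` are inverse bijections between the graphs of `A` with that
edge and those without it, and the weights are in ratio `p : 1 - p`. -/
theorem randomGraph_real_inter_adj {n : ℕ} {p : ℝ} (h0 : 0 ≤ p) (h1 : p ≤ 1) {u v : Fin n}
    (huv : u ≠ v) {A : Set (SimpleGraph (Fin n))} (hA : EdgeFree u v A) :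
    (randomGraph n p).real (A ∩ {G | G.Adj u v}) = p * (randomGraph n p).real A := by
  classical
  let _ : Fintype (SimpleGraph (Fin n)) := Fintype.ofFinite _
  set w : SimpleGraph (Fin n) → ℝ := fun G => (randomGraph n p).real {G}
  have hsum : ∀ B : Set (SimpleGraph (Fin n)), (randomGraph n p).real B =
      ∑ G ∈ Finset.univ.filter (· ∈ B), w G := fun B => by
    rw [sum_measureReal_singleton]; congr; ext; simp
  have hdel : ∀ G : SimpleGraph (Fin n), G.deleteEdges {s(u, v)} ∈ A ↔ G ∈ A := fun G =>
    hA _ _ fun x y hxy => by simp [SimpleGraph.deleteEdges_adj, hxy]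
  have hadd : ∀ G : SimpleGraph (Fin n), G ⊔ SimpleGraph.edge u v ∈ A ↔ G ∈ A := fun G =>
    hA _ _ fun x y hxy => by
      rw [SimpleGraph.sup_adj, SimpleGraph.edge_adj]
      simp only [or_iff_left_iff_imp, and_imp]
      rintro (⟨rfl, rfl⟩ | ⟨rfl, rfl⟩) -
      · exact absurd rfl hxy
      · exact absurd Sym2.eq_swap hxy
  have key : (1 - p) * (randomGraph n p).real (A ∩ {G | G.Adj u v}) =
      p * (randomGraph n p).real (A \ {G | G.Adj u v}) := by
    rw [hsum, hsum, Finset.mul_sum, Finset.mul_sum]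
    refine Finset.sum_bij' (fun G _ => G.deleteEdges {s(u, v)})
      (fun G _ => G ⊔ SimpleGraph.edge u v) ?_ ?_ ?_ ?_ ?_
    · intro G hG
      simp only [Finset.mem_filter, Finset.mem_univ, true_and, Set.mem_inter_iff, Set.mem_sdiff,
        Set.mem_ofPred_eq, hdel] at hG ⊢
      exact ⟨hG.1, by simp [SimpleGraph.deleteEdges_adj]⟩
    · intro G hG
      simp only [Finset.mem_filter, Finset.mem_univ, true_and, Set.mem_inter_iff, Set.mem_sdiff,
        Set.mem_ofPred_eq, hadd] at hG ⊢
      exact ⟨hG.1, by simp [SimpleGraph.edge_adj, huv]⟩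
    · intro G hG
      have hG' : G.Adj u v := by simp at hG; exact hG.2
      ext x y
      simp only [SimpleGraph.sup_adj, SimpleGraph.deleteEdges_adj, SimpleGraph.edge_adj,
        Set.mem_singleton_iff, Sym2.eq_iff]
      have := hG'.symm
      by_cases hxy : x = u ∧ y = v ∨ x = v ∧ y = u
      · rcases hxy with ⟨rfl, rfl⟩ | ⟨rfl, rfl⟩ <;> simp [*, huv.symm]
      · simp [hxy]
    · intro G hG
      have hG' : ¬ G.Adj u v := by simp at hG; exact hG.2
      ext x y
      simp only [SimpleGraph.sup_adj, SimpleGraph.deleteEdges_adj, SimpleGraph.edge_adj,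
        Set.mem_singleton_iff, Sym2.eq_iff]
      have : ¬ G.Adj v u := fun h => hG' h.symm
      by_cases hxy : x = u ∧ y = v ∨ x = v ∧ y = u
      · rcases hxy with ⟨rfl, rfl⟩ | ⟨rfl, rfl⟩ <;> simp [*]
      · simp [hxy]
    · intro G hG
      exact randomGraph_real_deleteEdges h0 h1 (by simp at hG; exact hG.2)
  have htot := measureReal_inter_add_sdiff (μ := randomGraph n p) (s := A)
    (t := {G | G.Adj u v}) (Set.toFinite _).measurableSet
  linear_combination key + p * htot

theorem measureReal_prod_eq_sum {α β : Type*} [Fintype α] [Finite β] [MeasurableSpace α]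
    [MeasurableSpace β] [MeasurableSingletonClass α] [MeasurableSingletonClass β] (μ : Measure α)
    (ν : Measure β) [IsProbabilityMeasure μ] [IsProbabilityMeasure ν] (B : Set (α × β)) :
    (μ.prod ν).real B = ∑ a, μ.real {a} * ν.real {b | (a, b) ∈ B} := by
  rw [measureReal_def, Measure.prod_apply (Set.toFinite B).measurableSet, lintegral_fintype,
    ENNReal.toReal_sum fun a _ => ENNReal.mul_ne_top (measure_ne_top _ _) (measure_ne_top _ _)]
  refine Finset.sum_congr rfl fun a _ => ?_
  rw [ENNReal.toReal_mul, mul_comm]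
  rfl

theorem measureReal_prod_eq_sum_symm {α β : Type*} [Finite α] [Fintype β] [MeasurableSpace α]
    [MeasurableSpace β] [MeasurableSingletonClass α] [MeasurableSingletonClass β] (μ : Measure α)
    (ν : Measure β) [IsProbabilityMeasure μ] [IsProbabilityMeasure ν] (B : Set (α × β)) :
    (μ.prod ν).real B = ∑ b, ν.real {b} * μ.real {a | (a, b) ∈ B} := by
  rw [measureReal_def, Measure.prod_apply_symm (Set.toFinite B).measurableSet, lintegral_fintype,
    ENNReal.toReal_sum fun a _ => ENNReal.mul_ne_top (measure_ne_top _ _) (measure_ne_top _ _)]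
  refine Finset.sum_congr rfl fun a _ => ?_
  rw [ENNReal.toReal_mul, mul_comm]
  rfl

/-! ### Edge probabilities with a planted set -/

/-- `G(n, p, k, q)` for a given planted set. -/
noncomputable def splicedGraph (n : ℕ) (p q : ℝ) (S : Finset (Fin n)) :
    Measure (SimpleGraph (Fin n)) :=
  ((randomGraph n p).prod (randomGraph n q)).map fun x => splice S x.1 x.2

instance (n : ℕ) (p q : ℝ) (S : Finset (Fin n)) : IsProbabilityMeasure (splicedGraph n p q S) :=
  Measure.isProbabilityMeasure_map (measurable_of_finite _).aemeasurable

theorem splicedGraph_real {n : ℕ} (p q : ℝ) (S : Finset (Fin n)) (A : Set (SimpleGraph (Fin n))) :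
    (splicedGraph n p q S).real A =
      ((randomGraph n p).prod (randomGraph n q)).real {x | splice S x.1 x.2 ∈ A} := by
  rw [splicedGraph, map_measureReal_apply (measurable_of_finite _) (Set.toFinite A).measurableSet]
  rfl

/-- The pair `uv` is read from only one of the two independent graphs. With the other one fixed, the
preimage of `A` is still `EdgeFree`, and the case of a single random graph applies. -/
theorem splicedGraph_real_inter_adj {n : ℕ} {p q : ℝ} (hp0 : 0 ≤ p) (hp1 : p ≤ 1) (hq0 : 0 ≤ q)
    (hq1 : q ≤ 1) {u v : Fin n} (huv : u ≠ v) {S : Finset (Fin n)}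
    {A : Set (SimpleGraph (Fin n))} (hA : EdgeFree u v A) :
    (splicedGraph n p q S).real (A ∩ {G | G.Adj u v}) =
      (if u ∈ S ∧ v ∈ S then q else p) * (splicedGraph n p q S).real A := by
  classical
  let _ : Fintype (SimpleGraph (Fin n)) := Fintype.ofFinite _
  rw [splicedGraph_real, splicedGraph_real]
  split_ifs with h
  · rw [measureReal_prod_eq_sum, measureReal_prod_eq_sum, Finset.mul_sum]
    refine Finset.sum_congr rfl fun H _ => ?_
    have h1 : EdgeFree u v {K | splice S H K ∈ A} := fun K K' hK => hA _ _ fun x y hxy => by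
      simp only [splice, hK x y hxy]
    have h2 := randomGraph_real_inter_adj hq0 hq1 huv h1
    have h3 : {K | (H, K) ∈ {x | splice S x.1 x.2 ∈ A ∩ {G | G.Adj u v}}} =
        {K | splice S H K ∈ A} ∩ {G | G.Adj u v} := by
      ext K; simp [splice, h]
    rw [h3, h2]
    simp only [Set.mem_ofPred_eq]
    ring
  · rw [measureReal_prod_eq_sum_symm, measureReal_prod_eq_sum_symm, Finset.mul_sum]
    refine Finset.sum_congr rfl fun K _ => ?_
    have h1 : EdgeFree u v {H | splice S H K ∈ A} := fun H H' hH => hA _ _ fun x y hxy => by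
      simp only [splice, hH x y hxy]
    have h2 := randomGraph_real_inter_adj hp0 hp1 huv h1
    have h3 : {H | (H, K) ∈ {x | splice S x.1 x.2 ∈ A ∩ {G | G.Adj u v}}} =
        {H | splice S H K ∈ A} ∩ {G | G.Adj u v} := by
      ext H
      have : (splice S H K).Adj u v ↔ H.Adj u v := by simp only [splice, h, false_and, not_false_iff, true_and, false_or]
      exact and_congr_right fun _ => this
    rw [h3, h2]
    simp only [Set.mem_ofPred_eq]
    ring

theorem plantedGraph_eq (n : ℕ) (p : ℝ) (k : ℕ) (q : ℝ) : plantedGraph n p k q =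
    ∑ S ∈ (Finset.univ : Finset (Fin n)).powersetCard k,
      (n.choose k : ENNReal)⁻¹ • splicedGraph n p q S := rfl

theorem isProbabilityMeasure_plantedGraph {n k : ℕ} (hk : k ≤ n) (p q : ℝ) :
    IsProbabilityMeasure (plantedGraph n p k q) := by
  constructor
  have h : (n.choose k : ENNReal) ≠ 0 := by exact_mod_cast (Nat.choose_pos hk).ne'
  rw [plantedGraph_eq]
  simp [Measure.finsetSum_apply, ENNReal.mul_inv_cancel h]

theorem plantedGraph_real {n : ℕ} (p : ℝ) (k : ℕ) (q : ℝ) (A : Set (SimpleGraph (Fin n))) :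
    (plantedGraph n p k q).real A = ∑ S ∈ (Finset.univ : Finset (Fin n)).powersetCard k,
      (n.choose k : ℝ)⁻¹ * (splicedGraph n p q S).real A := by
  rw [plantedGraph_eq, measureReal_def, Measure.finsetSum_apply]
  simp only [Measure.smul_apply, smul_eq_mul]
  rw [ENNReal.toReal_sum]
  · simp [measureReal_def]
  · intro S hS
    have h : (n.choose k : ENNReal) ≠ 0 := by
      have h1 := Finset.card_le_univ S
      rw [(Finset.mem_powersetCard.1 hS).2, Fintype.card_fin] at h1
      exact_mod_cast (Nat.choose_pos h1).ne'
    exact ENNReal.mul_ne_top (ENNReal.inv_ne_top.2 h) (measure_ne_top _ _)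

/-- Each pair of vertices is adjacent with probability at most `q`, given the other pairs. -/
def EdgeBound {n : ℕ} (μ : Measure (SimpleGraph (Fin n))) (q : ℝ) : Prop :=
  ∀ u v, u ≠ v → ∀ A, EdgeFree u v A → μ.real (A ∩ {G | G.Adj u v}) ≤ q * μ.real A

theorem edgeBound_randomGraph {n : ℕ} {p : ℝ} (h0 : 0 ≤ p) (h1 : p ≤ 1) :
    EdgeBound (randomGraph n p) p :=
  fun _ _ huv _ hA => (randomGraph_real_inter_adj h0 h1 huv hA).le

/-- Given the other pairs, the conditional edge probability is an average over `S` of values `p` and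
`q`. Independence is lost in the mixture, but the upper bound `q` survives, and only that is used
later. -/
theorem edgeBound_plantedGraph {n k : ℕ} {p q : ℝ} (h0 : 0 ≤ p) (hpq : p ≤ q) (h1 : q ≤ 1) :
    EdgeBound (plantedGraph n p k q) q := by
  intro u v huv A hA
  rw [plantedGraph_real, plantedGraph_real, Finset.mul_sum]
  refine Finset.sum_le_sum fun S _ => ?_
  rw [splicedGraph_real_inter_adj h0 (hpq.trans h1) (h0.trans hpq) h1 huv hA, mul_left_comm]
  gcongr
  split_ifs <;> simp [hpq]

/-! ## Coins -/

instance (m : ℕ) : IsProbabilityMeasure (coinLaw m) :=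
  isProbabilityMeasure_uniformOn Set.finite_univ Set.univ_nonempty

theorem integral_coinLaw {m : ℕ} (f : (Fin m → Bool) → ℝ) :
    ∫ r, f r ∂(coinLaw m) = ((2 : ℝ) ^ m)⁻¹ * ∑ r, f r := by
  rw [integral_fintype .of_finite, Finset.mul_sum]
  refine Finset.sum_congr rfl fun r _ => ?_
  rw [coinLaw, measureReal_def, uniformOn_univ]
  simp

/-- Surplus coins integrate out, so the learner's regret guarantee transfers to the coins of the
test. -/
theorem integral_coinLaw_castLE {m k : ℕ} (h : m ≤ k) (f : (Fin m → Bool) → ℝ) :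
    ∫ r, f (fun s => r (Fin.castLE h s)) ∂(coinLaw k) = ∫ r, f r ∂(coinLaw m) := by
  obtain ⟨d, rfl⟩ := Nat.exists_eq_add_of_le h
  rw [integral_coinLaw, integral_coinLaw, ← (Fin.appendEquiv m d).sum_comp, Fintype.sum_prod_type]
  have : ∀ (x : Fin m → Bool) (y : Fin d → Bool),
      (fun s => (Fin.appendEquiv m d) (x, y) (Fin.castLE h s)) = x := fun x y => by
    funext s
    exact Fin.append_left x y s
  simp only [this, Finset.sum_const, Finset.card_univ, Fintype.card_fun, Fintype.card_bool,
    Fintype.card_fin, nsmul_eq_mul, ← Finset.mul_sum]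
  rw [pow_add]
  push_cast
  field_simp

/-! ## The payoff in the game on a random graph -/

section

variable {N : ℕ} {m L : ℕ+} {A : Learner}

theorem edgeAt_congr {G H : SimpleGraph (Fin N)} {u v : Fin N} {x y : ℕ}
    (h : ∀ x y, s(x, y) ≠ s(u, v) → (G.Adj x y ↔ H.Adj x y))
    (hxy : ¬ (x = u ∧ y = v)) (hyx : ¬ (x = v ∧ y = u)) : edgeAt G x y ↔ edgeAt H x y := by
  refine exists_congr fun hx => exists_congr fun hy => h _ _ fun he => ?_
  rw [Sym2.eq_iff] at he
  rcases he with ⟨h1, h2⟩ | ⟨h1, h2⟩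
  · exact hxy ⟨congrArg Fin.val h1, congrArg Fin.val h2⟩
  · exact hyx ⟨congrArg Fin.val h1, congrArg Fin.val h2⟩

theorem block_left_lt_right (t t' : Fin (m * m : ℕ+)) (a b : Fin L) :
    (t : ℕ) / m * L + a < (m + (t' : ℕ) % m) * L + b := by
  have h : (t : ℕ) < m * m := t.2
  have h1 : (t : ℕ) / m + 1 ≤ m := Nat.div_lt_of_lt_mul h
  have h2 := Nat.mul_le_mul_right (L : ℕ) h1
  have h3 := a.2
  have h4 : (m : ℕ) * L ≤ (m + (t' : ℕ) % m) * L := Nat.mul_le_mul_right _ (Nat.le_add_right _ _)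
  rw [add_mul, one_mul] at h2
  omega

/-- Round `t` is determined by its two blocks, so no other round reads a pair between them. The pair
cannot occur in reverse order either, as left blocks precede right blocks. -/
theorem blockRound_congr {G H : SimpleGraph (Fin N)} {s t : Fin (m * m : ℕ+)} (hst : s ≠ t)
    {a b : Fin L} {u v : Fin N} (hu : (u : ℕ) = t / m * L + a) (hv : (v : ℕ) = (m + t % m) * L + b)
    (h : ∀ x y, s(x, y) ≠ s(u, v) → (G.Adj x y ↔ H.Adj x y)) :
    blockRound G m L s = blockRound H m L s := by
  have key : ∀ a' b' : Fin L, edgeAt G (s / m * L + a') ((m + s % m) * L + b') ↔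
      edgeAt H (s / m * L + a') ((m + s % m) * L + b') := by
    intro a' b'
    have hblock : ∀ (x y : ℕ) (c d : Fin L), x * L + c = y * L + d → x = y := by
      intro x y c d hcd
      have h1 : (x * L + c) / (L : ℕ) = (y * L + d) / (L : ℕ) := by rw [hcd]
      rwa [mul_comm x, mul_comm y, Nat.mul_add_div L.pos, Nat.mul_add_div L.pos,
        Nat.div_eq_of_lt c.2, Nat.div_eq_of_lt d.2] at h1
    refine edgeAt_congr h (fun hxy => hst ?_) fun hyx => ?_
    · have h1 := hblock _ _ _ _ (hxy.1.trans hu)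
      have h2 := hblock _ _ _ _ (hxy.2.trans hv)
      refine Fin.ext ?_
      rw [← Nat.div_add_mod (s : ℕ) m, ← Nat.div_add_mod (t : ℕ) m, h1,
        Nat.add_left_cancel h2]
    · have h1 := block_left_lt_right s t a' b
      rw [← hv, ← hyx.1] at h1
      exact lt_irrefl _ h1
  classical
  rw [blockRound, blockRound, Round.mk.injEq]
  exact ⟨rfl, rfl, funext₂ fun a' b' => if_congr (key a' b') rfl rfl⟩

theorem blockLabel_congr {G H : SimpleGraph (Fin N)} {t : Fin (m * m : ℕ+)}
    (r : Fin (A.coins.eval ((2 * m : ℕ+) + L + (m * m : ℕ+) : ℕ)) → Bool)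
    (h : ∀ s < t, blockRound G m L s = blockRound H m L s) :
    blockLabel A G m L r t = blockLabel A H m L r t := by
  have : viewAt (blockRound G m L) t = viewAt (blockRound H m L) t := by
    have h1 : (List.ofFn (blockRound G m L)).take t = (List.ofFn (blockRound H m L)).take t := by
      refine List.ext_getElem (by simp only [List.length_take, List.length_ofFn]) fun i h1 h2 => ?_
      have h3 : i < t := by rw [List.length_take] at h1; omega
      simp only [List.getElem_take, List.getElem_ofFn]
      exact h _ (Fin.lt_def.2 h3)
    simp only [viewAt, h1]
    rfl
  rw [blockLabel, blockLabel, this]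

theorem blockHit_iff {G : SimpleGraph (Fin N)} {t : Fin (m * m : ℕ+)}
    (r : Fin (A.coins.eval ((2 * m : ℕ+) + L + (m * m : ℕ+) : ℕ)) → Bool) :
    blockHit A G m L r t ↔
      (blockRound G m L t).payoff (blockLabel A G m L r t).1 (blockLabel A G m L r t).2 = 1 := by
  simp [blockRound, blockHit]

theorem blockHit_congr {G H : SimpleGraph (Fin N)} {t : Fin (m * m : ℕ+)}
    (r : Fin (A.coins.eval ((2 * m : ℕ+) + L + (m * m : ℕ+) : ℕ)) → Bool)
    (h : ∀ s ≤ t, blockRound G m L s = blockRound H m L s) :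
    blockHit A G m L r t ↔ blockHit A H m L r t := by
  rw [blockHit_iff, blockHit_iff, h t le_rfl, blockLabel_congr r fun s hs => h s hs.le]

variable (m L) in
/-- Membership in `B` does not depend on round `t` of the game. -/
def RoundFree (t : Fin (m * m : ℕ+)) (B : Set (SimpleGraph (Fin N))) : Prop :=
  ∀ G H : SimpleGraph (Fin N), (∀ s, s ≠ t → blockRound G m L s = blockRound H m L s) →
    (G ∈ B ↔ H ∈ B)

theorem RoundFree.edgeFree {t : Fin (m * m : ℕ+)} {B : Set (SimpleGraph (Fin N))}
    (hB : RoundFree m L t B) {a b : Fin L} {u v : Fin N} (hu : (u : ℕ) = t / m * L + a)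
    (hv : (v : ℕ) = (m + t % m) * L + b) : EdgeFree u v B :=
  fun G H h => hB G H fun _ hs => blockRound_congr hs hu hv h

variable {μ : Measure (SimpleGraph (Fin N))} [IsProbabilityMeasure μ] {q : ℝ}

/-- Split according to the labels `c` chosen in round `t`. They depend on earlier rounds only, so `B
∩ {label = c}` is free of round `t`; for fixed `c` a hit is the adjacency of one fixed pair, to
which `EdgeBound` applies. -/
theorem EdgeBound.inter_blockHit (hμ : EdgeBound μ q) (hq : 0 ≤ q)
    (r : Fin (A.coins.eval ((2 * m : ℕ+) + L + (m * m : ℕ+) : ℕ)) → Bool)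
    {t : Fin (m * m : ℕ+)} {B : Set (SimpleGraph (Fin N))} (hB : RoundFree m L t B) :
    μ.real (B ∩ {G | blockHit A G m L r t}) ≤ q * μ.real B := by
  have hone : ∀ c : Fin L × Fin L,
      μ.real ((B ∩ {G | blockLabel A G m L r t = c}) ∩ {G | blockHit A G m L r t}) ≤
        q * μ.real (B ∩ {G | blockLabel A G m L r t = c}) := by
    intro c
    have hfree : RoundFree m L t (B ∩ {G : SimpleGraph (Fin N) | blockLabel A G m L r t = c}) :=
      fun G H h => and_congr (hB G H h) (by
        rw [Set.mem_ofPred_eq, Set.mem_ofPred_eq, blockLabel_congr r fun s hs => h s hs.ne])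
    by_cases hN : (t : ℕ) / m * L + c.1 < N ∧ ((m : ℕ) + t % m) * L + c.2 < N
    · refine (measureReal_mono ?_).trans (hμ ⟨_, hN.1⟩ ⟨_, hN.2⟩ ?_ _ (hfree.edgeFree rfl rfl))
      · rintro G ⟨hG, hh⟩
        have hc : blockLabel A G m L r t = c := hG.2
        rw [Set.mem_ofPred_eq, blockHit, hc] at hh
        exact ⟨hG, hh.2.2⟩
      · exact fun h => (block_left_lt_right t t c.1 c.2).ne (congrArg Fin.val h)
    · rw [show (B ∩ {G | blockLabel A G m L r t = c}) ∩ {G | blockHit A G m L r t} = ∅ from ?_]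
      · simp only [measureReal_empty]
        positivity
      · refine Set.eq_empty_of_forall_notMem ?_
        rintro G ⟨hG, hh⟩
        have hc : blockLabel A G m L r t = c := hG.2
        rw [Set.mem_ofPred_eq, blockHit, hc] at hh
        exact hN ⟨hh.1, hh.2.1⟩
  have hsplit : ∀ D : Set (SimpleGraph (Fin N)),
      ∑ c, μ.real (D ∩ {G | blockLabel A G m L r t = c}) = μ.real D := by
    intro D
    rw [← measureReal_biUnion_finset]
    · congr 1
      ext G
      simp
    · intro c _ c' _ hcc
      exact Set.disjoint_left.2 fun G h h' => hcc (h.2.symm.trans h'.2)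
    · exact fun c _ => (Set.toFinite _).measurableSet
  calc μ.real (B ∩ {G | blockHit A G m L r t})
      = ∑ c, μ.real ((B ∩ {G | blockLabel A G m L r t = c}) ∩ {G | blockHit A G m L r t}) := by
        rw [← hsplit]
        simp only [Set.inter_right_comm]
    _ ≤ ∑ c, q * μ.real (B ∩ {G | blockLabel A G m L r t = c}) :=
        Finset.sum_le_sum fun c _ => hone c
    _ = q * μ.real B := by rw [← Finset.mul_sum, hsplit]

theorem EdgeBound.blockHit (hμ : EdgeBound μ q) (hq : 0 ≤ q)
    (r : Fin (A.coins.eval ((2 * m : ℕ+) + L + (m * m : ℕ+) : ℕ)) → Bool)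
    (t : Fin (m * m : ℕ+)) : μ.real {G | blockHit A G m L r t} ≤ q := by
  simpa using hμ.inter_blockHit hq r (t := t) (B := Set.univ) fun _ _ _ => Iff.rfl

/-- A hit in the earlier of the two rounds is an event free of the later round. -/
theorem EdgeBound.blockHit_inter_blockHit (hμ : EdgeBound μ q) (hq : 0 ≤ q)
    (r : Fin (A.coins.eval ((2 * m : ℕ+) + L + (m * m : ℕ+) : ℕ)) → Bool)
    {s t : Fin (m * m : ℕ+)} (hst : s ≠ t) :
    μ.real ({G | _root_.blockHit A G m L r s} ∩ {G | _root_.blockHit A G m L r t}) ≤ q * q := by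
  wlog h : s < t generalizing s t
  · rw [Set.inter_comm]
    exact this hst.symm (lt_of_le_of_ne (not_lt.1 h) hst.symm)
  refine (hμ.inter_blockHit hq r fun G H hGH => ?_).trans
    (mul_le_mul_of_nonneg_left (hμ.blockHit hq r s) hq)
  exact blockHit_congr r fun s' hs' => hGH s' (hs'.trans_lt h).ne

theorem card_univ_rounds : (Finset.univ : Finset (Fin (m * m : ℕ+))).card = (m : ℕ) * m :=
  Finset.card_fin _

open Classical in
theorem cast_blockScore (G : SimpleGraph (Fin N))
    (r : Fin (A.coins.eval ((2 * m : ℕ+) + L + (m * m : ℕ+) : ℕ)) → Bool) :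
    (blockScore A G m L r : ℝ) =
      ∑ t, ({G | blockHit A G m L r t} : Set (SimpleGraph (Fin N))).indicator (fun _ => (1 : ℝ)) G := by
  rw [blockScore, Nat.cast_sum]
  refine Finset.sum_congr rfl fun t _ => ?_
  simp [Set.indicator_apply]

theorem integral_indicator_one_of_finite {α : Type*} [Finite α] [MeasurableSpace α]
    [MeasurableSingletonClass α] (μ : Measure α) (B : Set α) :
    ∫ x, B.indicator (fun _ => (1 : ℝ)) x ∂μ = μ.real B :=
  integral_indicator_one (Set.toFinite B).measurableSet

theorem EdgeBound.integral_blockScore_le (hμ : EdgeBound μ q) (hq : 0 ≤ q)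
    (r : Fin (A.coins.eval ((2 * m : ℕ+) + L + (m * m : ℕ+) : ℕ)) → Bool) :
    ∫ G, (blockScore A G m L r : ℝ) ∂μ ≤ q * (m * m) := by
  simp only [cast_blockScore]
  rw [integral_finsetSum _ fun t _ => .of_finite]
  simp only [integral_indicator_one_of_finite]
  refine (Finset.sum_le_card_nsmul _ _ q fun t _ => hμ.blockHit hq r t).trans (le_of_eq ?_)
  rw [card_univ_rounds, nsmul_eq_mul, Nat.cast_mul, mul_comm]

theorem EdgeBound.integral_blockScore_sq_le (hμ : EdgeBound μ q) (hq : 0 ≤ q)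
    (r : Fin (A.coins.eval ((2 * m : ℕ+) + L + (m * m : ℕ+) : ℕ)) → Bool) :
    ∫ G, (blockScore A G m L r : ℝ) ^ 2 ∂μ ≤ q * (m * m) + (q * (m * m)) ^ 2 := by
  simp only [cast_blockScore, sq, Finset.sum_mul_sum]
  rw [integral_finsetSum _ fun t _ => .of_finite]
  have h1 : ∀ s : Fin (m * m : ℕ+), ∫ G, ∑ t,
      ({G | _root_.blockHit A G m L r s} : Set (SimpleGraph (Fin N))).indicator (fun _ => (1 : ℝ)) G *
      ({G | _root_.blockHit A G m L r t} : Set (SimpleGraph (Fin N))).indicator (fun _ => (1 : ℝ)) G ∂μ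
      ≤ q + (m * m) * (q * q) := by
    intro s
    rw [integral_finsetSum _ fun t _ => .of_finite]
    simp only [← Set.inter_indicator_mul, mul_one, integral_indicator_one_of_finite]
    have h2 : ∀ t, μ.real ({G | _root_.blockHit A G m L r s} ∩ {G | _root_.blockHit A G m L r t}) ≤
        (if s = t then q else 0) + q * q := by
      intro t
      split_ifs with hst
      · subst hst
        rw [Set.inter_self]
        have := hμ.blockHit hq r s
        nlinarith
      · rw [zero_add]
        exact hμ.blockHit_inter_blockHit hq r hst
    refine (Finset.sum_le_sum fun t _ => h2 t).trans ?_
    rw [Finset.sum_add_distrib, Finset.sum_const, card_univ_rounds, Finset.sum_ite_eq,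
      if_pos (Finset.mem_univ _), nsmul_eq_mul, Nat.cast_mul]
  refine (Finset.sum_le_card_nsmul _ _ _ fun s _ => h1 s).trans (le_of_eq ?_)
  rw [card_univ_rounds, nsmul_eq_mul, Nat.cast_mul]
  ring

variable {R : Type} [Fintype R] [MeasurableSpace R] [MeasurableSingletonClass R] {ν : Measure R}
  [IsProbabilityMeasure ν]

theorem EdgeBound.real_le_blockScore (hμ : EdgeBound μ q) (hq : 0 ≤ q)
    (φ : R → Fin (A.coins.eval ((2 * m : ℕ+) + L + (m * m : ℕ+) : ℕ)) → Bool) {θ : ℝ}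
    (hθ : 0 < θ) :
    (μ.prod ν).real {x | θ ≤ blockScore A x.1 m L (φ x.2)} ≤ q * (m * m) / θ := by
  rw [le_div_iff₀' hθ]
  refine (mul_meas_ge_le_integral_of_nonneg (μ := μ.prod ν)
    (f := fun x => (blockScore A x.1 m L (φ x.2) : ℝ)) (ae_of_all _ fun x => by positivity)
    .of_finite θ).trans ?_
  rw [integral_prod_symm _ .of_finite]
  refine (integral_mono (μ := ν) .of_finite .of_finite
    fun r => hμ.integral_blockScore_le hq (φ r)).trans ?_
  simp

/-- Chebyshev's inequality about `M = q * m²`, an upper bound for the mean, instead of the mean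
itself. The second moment is at most `M + M²` and the mean at least `M * (1 - η)`, so the expected
squared deviation is at most `M + 2 * M² * η`; division by `(M / 2)²` gives the bound. -/
theorem EdgeBound.real_blockScore_le (hμ : EdgeBound μ q) (hq : 0 < q)
    (φ : R → Fin (A.coins.eval ((2 * m : ℕ+) + L + (m * m : ℕ+) : ℕ)) → Bool) {η : ℝ}
    (hη : q * (m * m) * (1 - η) ≤ ∫ r, ∫ G, (blockScore A G m L (φ r) : ℝ) ∂μ ∂ν) :
    (μ.prod ν).real {x | (blockScore A x.1 m L (φ x.2) : ℝ) ≤ q * (m * m) / 2} ≤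
      4 / (q * (m * m)) + 8 * η := by
  have hm : (0 : ℝ) < m := by exact_mod_cast m.pos
  set M : ℝ := q * (m * m) with hM
  have hM0 : 0 < M := by positivity
  have h1 : (M / 2) ^ 2 * (μ.prod ν).real {x | (blockScore A x.1 m L (φ x.2) : ℝ) ≤ M / 2} ≤
      ∫ x, ((blockScore A x.1 m L (φ x.2) : ℝ) - M) ^ 2 ∂(μ.prod ν) := by
    refine le_trans ?_ (mul_meas_ge_le_integral_of_nonneg (μ := μ.prod ν)
      (f := fun x => ((blockScore A x.1 m L (φ x.2) : ℝ) - M) ^ 2)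
      (ae_of_all _ fun x => sq_nonneg _) .of_finite ((M / 2) ^ 2))
    refine mul_le_mul_of_nonneg_left (measureReal_mono fun x hx => ?_) (sq_nonneg _)
    simp only [Set.mem_ofPred_eq] at hx ⊢
    nlinarith
  have h2 : ∫ x, ((blockScore A x.1 m L (φ x.2) : ℝ) - M) ^ 2 ∂(μ.prod ν) =
      ∫ r, ∫ G, (blockScore A G m L (φ r) : ℝ) ^ 2 ∂μ ∂ν
        - 2 * M * ∫ r, ∫ G, (blockScore A G m L (φ r) : ℝ) ∂μ ∂ν + M ^ 2 := by
    rw [← integral_prod_symm (μ := μ) (ν := ν)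
        (fun x => (blockScore A x.1 m L (φ x.2) : ℝ)) .of_finite,
      ← integral_prod_symm (μ := μ) (ν := ν)
        (fun x => (blockScore A x.1 m L (φ x.2) : ℝ) ^ 2) .of_finite,
      ← integral_const_mul, ← integral_sub .of_finite .of_finite]
    have h3 : M ^ 2 = ∫ _x, M ^ 2 ∂(μ.prod ν) := by simp
    rw [h3, ← integral_add .of_finite .of_finite]
    refine integral_congr_ae (ae_of_all _ fun x => ?_)
    ring
  have h4 : ∫ r, ∫ G, (blockScore A G m L (φ r) : ℝ) ^ 2 ∂μ ∂ν ≤ M + M ^ 2 := by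
    refine (integral_mono (μ := ν) .of_finite .of_finite
      fun r => hμ.integral_blockScore_sq_le hq.le (φ r)).trans ?_
    simp [hM]
  have h5 : (M / 2) ^ 2 * (μ.prod ν).real {x | (blockScore A x.1 m L (φ x.2) : ℝ) ≤ M / 2} ≤
      (M / 2) ^ 2 * (4 / M + 8 * η) := by
    have h6 : (M / 2) ^ 2 * (4 / M + 8 * η) = M + 2 * M ^ 2 * η := by field_simp; ring
    rw [h6]
    have h7 := mul_le_mul_of_nonneg_left hη (by positivity : 0 ≤ 2 * M)
    rw [h2] at h1
    nlinarith
  exact le_of_mul_le_mul_left h5 (by positivity)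

end

/-! ## The best labeling on a planted graph -/

/-- The left side counts the sets with at most one element among the `L` added ones. -/
theorem Nat.choose_succ_add_mul_le (M L k : ℕ) :
    M.choose (k + 1) + L * M.choose k ≤ (M + L).choose (k + 1) := by
  induction L with
  | zero => simp
  | succ L ih =>
    have h1 := Nat.choose_succ_succ' (M + L) k
    have h2 := Nat.choose_le_choose k (Nat.le_add_right M L)
    rw [← Nat.add_assoc, h1, add_mul, one_mul]
    omega

/-- A random `k`-set of `M + L` elements thus misses `L` given ones with probability at most `(M +
L) / (k * L)`. Sets missing them are compared with sets containing exactly one of them. -/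
theorem Nat.choose_mul_mul_le (M L k : ℕ) :
    M.choose k * (k * L) ≤ (M + L) * (M + L).choose k := by
  cases k with
  | zero => simp
  | succ k =>
    have h1 := Nat.choose_succ_right_eq M k
    have h2 : M.choose k * (M - k) ≤ M.choose k * M := Nat.mul_le_mul_left _ (Nat.sub_le _ _)
    have h3 := Nat.choose_succ_add_mul_le M L k
    calc M.choose (k + 1) * ((k + 1) * L) = M.choose (k + 1) * (k + 1) * L := by ring
      _ ≤ M.choose k * M * L := by rw [h1]; gcongr
      _ = M * (L * M.choose k) := by ring
      _ ≤ (M + L) * (M + L).choose (k + 1) := by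
        refine Nat.mul_le_mul (Nat.le_add_right _ _) (by omega)

/-- Few sets of `k` elements avoid a given set `V`. -/
theorem Finset.card_filter_disjoint_mul_le {N : ℕ} (k : ℕ) (V : Finset (Fin N)) :
    (((Finset.univ : Finset (Fin N)).powersetCard k).filter (Disjoint V)).card * (k * V.card) ≤
      N * N.choose k := by
  have h1 : ((Finset.univ : Finset (Fin N)).powersetCard k).filter (Disjoint V) =
      Vᶜ.powersetCard k := by
    ext S
    simp only [Finset.mem_filter, Finset.mem_powersetCard, Finset.subset_univ, true_and,
      Finset.subset_compl_iff_disjoint_right, disjoint_comm, and_comm]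
  have h2 : V.card ≤ N := by simpa using V.card_le_univ
  have h3 := Nat.choose_mul_mul_le (N - V.card) V.card k
  rw [Nat.sub_add_cancel h2] at h3
  rwa [h1, Finset.card_powersetCard, Finset.card_compl, Fintype.card_fin]

section

variable {N : ℕ} {m L : ℕ+} {A : Learner}

/-- Block `i` of vertices. -/
def block (N L i : ℕ) : Finset (Fin N) :=
  Finset.univ.filter fun v => i * L ≤ v ∧ (v : ℕ) < i * L + L

theorem card_block {L i : ℕ} (h : i * L + L ≤ N) : (block N L i).card = L := by
  have : (block N L i).map Fin.valEmbedding = Finset.Ico (i * L) (i * L + L) := by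
    ext v
    simp only [block, Finset.mem_map, Finset.mem_filter, Finset.mem_univ, true_and,
      Fin.valEmbedding_apply, Finset.mem_Ico]
    exact ⟨by rintro ⟨w, hw, rfl⟩; exact hw, fun hv => ⟨⟨v, by omega⟩, hv, rfl⟩⟩
  rw [← Finset.card_map Fin.valEmbedding, this, Nat.card_Ico]
  omega

open Classical in
/-- A labeling that selects a vertex of `S` in each block that meets `S`. -/
noncomputable def blockLabeling (S : Finset (Fin N)) (L : ℕ+) (i : ℕ) : Fin L :=
  if h : ∃ a : Fin L, ∃ hv : i * L + a < N, (⟨i * L + a, hv⟩ : Fin N) ∈ S then h.choose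
  else ⟨0, L.pos⟩

theorem blockLabeling_mem {S : Finset (Fin N)} {i : ℕ} (h : ¬ Disjoint (block N L i) S) :
    ∃ hv : i * L + blockLabeling S L i < N, (⟨i * L + blockLabeling S L i, hv⟩ : Fin N) ∈ S := by
  have h1 : ∃ a : Fin L, ∃ hv : i * L + a < N, (⟨i * L + a, hv⟩ : Fin N) ∈ S := by
    obtain ⟨v, hv, hvS⟩ := Finset.not_disjoint_iff.1 h
    simp only [block, Finset.mem_filter, Finset.mem_univ, true_and] at hv
    refine ⟨⟨v - i * L, by omega⟩, ?_⟩
    have h2 : i * (L : ℕ) + (v - i * L) = v := by omega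
    simp only [h2]
    exact ⟨v.2, hvS⟩
  rw [blockLabeling, dif_pos h1]
  exact h1.choose_spec

open Classical in
theorem expectedPayoff_blockRound (G : SimpleGraph (Fin N)) :
    A.expectedPayoff (blockRound G m L) = ∫ r, (blockScore A G m L r : ℝ)
      ∂(coinLaw (A.coins.eval ((2 * m : ℕ+) + L + (m * m : ℕ+) : ℕ))) := by
  refine integral_congr_ae (ae_of_all _ fun r => ?_)
  simp only [Learner.totalPayoff, blockScore, Nat.cast_sum]
  refine Finset.sum_congr rfl fun t _ => ?_
  have h1 : (blockRound G m L t).payoff (blockLabel A G m L r t).1 (blockLabel A G m L r t).2 =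
      if blockHit A G m L r t then 1 else 0 := rfl
  rw [blockLabel] at h1
  rw [h1]
  by_cases h : blockHit A G m L r t <;> simp [h]

open Classical in
theorem le_bestPayoff_blockRound (G : SimpleGraph (Fin N)) (l : ℕ → Fin L) :
    ∑ t : Fin (m * m : ℕ+), ({G | edgeAt G (t / m * L + l (t / m))
      ((m + t % m) * L + l (m + t % m))} : Set (SimpleGraph (Fin N))).indicator
        (fun _ => (1 : ℝ)) G ≤ bestPayoff (blockRound G m L) := by
  refine le_trans (le_of_eq ?_) (le_ciSup (f := fun l : Fin (2 * m : ℕ+) → Fin L =>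
    ∑ t, ((blockRound G m L t).payoff (l (blockRound G m L t).i) (l (blockRound G m L t).j) : ℝ))
    (Set.finite_range _).bddAbove fun i => l i)
  refine Finset.sum_congr rfl fun t _ => ?_
  simp only [blockRound, Set.indicator_apply, Set.mem_ofPred_eq]
  split_ifs <;> simp

variable {p q : ℝ}

/-- The labeling is determined by `S` before the edges are drawn. If both blocks meet `S`, the
chosen pair lies inside `S` and is an edge with probability exactly `q`; otherwise the left side is
not positive. Its linear form in the two indicators suits averaging over `S`. -/
theorem splicedGraph_real_edgeAt (hp0 : 0 ≤ p) (hp1 : p ≤ 1) (hq0 : 0 ≤ q) (hq1 : q ≤ 1)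
    (S : Finset (Fin N)) (t : Fin (m * m : ℕ+)) :
    q * (1 - (if Disjoint (block N L (t / m)) S then 1 else 0)
      - (if Disjoint (block N L (m + t % m)) S then 1 else 0)) ≤
    (splicedGraph N p q S).real {G | edgeAt G (t / m * L + blockLabeling S L (t / m))
      ((m + t % m) * L + blockLabeling S L (m + t % m))} := by
  by_cases h1 : Disjoint (block N L (t / m)) S
  · refine le_trans ?_ measureReal_nonneg
    rw [if_pos h1]
    split_ifs <;> linarith
  by_cases h2 : Disjoint (block N L (m + t % m)) S
  · refine le_trans ?_ measureReal_nonneg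
    rw [if_neg h1, if_pos h2]
    linarith
  obtain ⟨hu, huS⟩ := blockLabeling_mem h1
  obtain ⟨hv, hvS⟩ := blockLabeling_mem h2
  have h3 := splicedGraph_real_inter_adj (u := ⟨_, hu⟩) (v := ⟨_, hv⟩) hp0 hp1 hq0 hq1
    (fun h => (block_left_lt_right t t _ _).ne (congrArg Fin.val h)) (S := S)
    (A := Set.univ) fun _ _ _ => Iff.rfl
  rw [if_pos ⟨huS, hvS⟩, Set.univ_inter, probReal_univ, mul_one] at h3
  rw [if_neg h1, if_neg h2, sub_zero, sub_zero, mul_one]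
  refine h3.ge.trans (measureReal_mono fun G hG => ?_)
  exact ⟨hu, hv, hG⟩

theorem sum_inv_choose_disjoint_le {k i : ℕ} (hk : 0 < k) (hkN : k ≤ N) (hi : i * L + L ≤ N) :
    ∑ S ∈ (Finset.univ : Finset (Fin N)).powersetCard k,
      (N.choose k : ℝ)⁻¹ * (if Disjoint (block N L i) S then 1 else 0) ≤ N / (k * L) := by
  rw [← Finset.mul_sum, Finset.sum_boole]
  have h1 := Finset.card_filter_disjoint_mul_le k (block N L i)
  rw [card_block hi] at h1
  have h2 : (0 : ℝ) < N.choose k := by exact_mod_cast Nat.choose_pos hkN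
  have h3 : (0 : ℝ) < k * L := by exact_mod_cast Nat.mul_pos hk L.pos
  rw [inv_mul_le_iff₀ h2, ← mul_div_assoc, le_div_iff₀ h3, mul_comm (N.choose k : ℝ)]
  exact_mod_cast h1

/-- The best labeling may depend on the graph, so for each `S` it does at least as well as the
labeling through planted vertices. Averaging over `S` replaces each indicator of a missed block by
its probability, at most `N / (k * L)`. -/
theorem le_integral_bestPayoff {k : ℕ} (hp0 : 0 ≤ p) (hp1 : p ≤ 1) (hq0 : 0 ≤ q) (hq1 : q ≤ 1)
    (hk : 0 < k) (hkN : k ≤ N) (hN : 2 * m * L ≤ N) :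
    q * (m * m) * (1 - 2 * (N / (k * L))) ≤
      ∫ G, bestPayoff (blockRound G m L) ∂(plantedGraph N p k q) := by
  have hC : (0 : ℝ) < N.choose k := by exact_mod_cast Nat.choose_pos hkN
  rw [plantedGraph_eq, integral_finsetSum_measure fun S _ => Integrable.smul_measure .of_finite
    (ENNReal.inv_ne_top.2 (by exact_mod_cast hC.ne'))]
  have hblock : ∀ i : ℕ, i < 2 * m → i * L + L ≤ N := fun i hi => by
    have := Nat.mul_le_mul_right (L : ℕ) (Nat.succ_le_of_lt hi)
    rw [Nat.succ_mul] at this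
    omega
  have hS : ∀ S : Finset (Fin N), ∑ t : Fin (m * m : ℕ+),
      q * (1 - (if Disjoint (block N L (t / m)) S then 1 else 0)
        - (if Disjoint (block N L (m + t % m)) S then 1 else 0)) ≤
      ∫ G, bestPayoff (blockRound G m L) ∂(splicedGraph N p q S) := by
    intro S
    refine le_trans ?_ (integral_mono .of_finite .of_finite
      fun G => le_bestPayoff_blockRound G (blockLabeling S L))
    rw [integral_finsetSum _ fun t _ => .of_finite]
    simp only [integral_indicator_one_of_finite]
    exact Finset.sum_le_sum fun t _ => splicedGraph_real_edgeAt hp0 hp1 hq0 hq1 S t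
  calc q * (m * m) * (1 - 2 * (N / (k * L)))
      = ∑ t : Fin (m * m : ℕ+), q * (1 - N / (k * L) - N / (k * L)) := by
        rw [Finset.sum_const, card_univ_rounds, nsmul_eq_mul, Nat.cast_mul]
        ring
    _ ≤ ∑ t : Fin (m * m : ℕ+), ∑ S ∈ (Finset.univ : Finset (Fin N)).powersetCard k,
        (N.choose k : ℝ)⁻¹ * (q * (1 - (if Disjoint (block N L (t / m)) S then 1 else 0)
        - (if Disjoint (block N L (m + t % m)) S then 1 else 0))) := by
      refine Finset.sum_le_sum fun t _ => ?_
      have ht : (t : ℕ) < m * m := t.2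
      have h1 := Nat.div_lt_of_lt_mul ht
      have h2 := Nat.mod_lt (t : ℕ) m.pos
      have h3 := sum_inv_choose_disjoint_le hk hkN (hblock (t / m) (by omega))
      have h4 := sum_inv_choose_disjoint_le hk hkN (hblock (m + t % m) (by omega))
      have h5 : ∑ S ∈ (Finset.univ : Finset (Fin N)).powersetCard k, (N.choose k : ℝ)⁻¹ = 1 := by
        simp [hC.ne']
      have h6 : ∀ d d' : Finset (Fin N) → ℝ,
          ∑ S ∈ (Finset.univ : Finset (Fin N)).powersetCard k,
            (N.choose k : ℝ)⁻¹ * (q * (1 - d S - d' S)) =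
          q * (1 - ∑ S ∈ (Finset.univ : Finset (Fin N)).powersetCard k, (N.choose k : ℝ)⁻¹ * d S
            - ∑ S ∈ (Finset.univ : Finset (Fin N)).powersetCard k, (N.choose k : ℝ)⁻¹ * d' S) := by
        intro d d'
        rw [Finset.sum_congr rfl fun S _ => show (N.choose k : ℝ)⁻¹ * (q * (1 - d S - d' S)) =
            q * ((N.choose k : ℝ)⁻¹ - (N.choose k : ℝ)⁻¹ * d S - (N.choose k : ℝ)⁻¹ * d' S) by ring,
          ← Finset.mul_sum, Finset.sum_sub_distrib, Finset.sum_sub_distrib, h5]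
      rw [h6]
      gcongr
    _ = ∑ S ∈ (Finset.univ : Finset (Fin N)).powersetCard k, (N.choose k : ℝ)⁻¹ *
        ∑ t : Fin (m * m : ℕ+), q * (1 - (if Disjoint (block N L (t / m)) S then 1 else 0)
        - (if Disjoint (block N L (m + t % m)) S then 1 else 0)) := by
      rw [Finset.sum_comm]
      simp only [Finset.mul_sum]
    _ ≤ _ := by
      refine Finset.sum_le_sum fun S _ => ?_
      rw [integral_smul_measure, smul_eq_mul]
      simp only [ENNReal.toReal_inv, ENNReal.toReal_natCast]
      exact mul_le_mul_of_nonneg_left (hS S) (by positivity)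

theorem le_integral_integral_blockScore {k : ℕ} {ρ : ℝ} (hp0 : 0 ≤ p) (hp1 : p ≤ 1) (hq0 : 0 ≤ q)
    (hq1 : q ≤ 1) (hk : 0 < k) (hkN : k ≤ N) (hN : 2 * m * L ≤ N)
    (hρ : ∀ x : Fin (m * m : ℕ+) → Round (2 * m : ℕ+) L, bestPayoff x - A.expectedPayoff x ≤ ρ) :
    q * (m * m) * (1 - 2 * (N / (k * L))) - ρ ≤
      ∫ r, ∫ G, (blockScore A G m L r : ℝ) ∂(plantedGraph N p k q)
        ∂(coinLaw (A.coins.eval ((2 * m : ℕ+) + L + (m * m : ℕ+) : ℕ))) := by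
  have := isProbabilityMeasure_plantedGraph hkN p q
  -- Regret is controlled for a fixed graph on average over the coins, whereas the moment bounds
  -- hold for fixed coins on average over the graph.
  rw [integral_integral_swap .of_finite]
  simp only [← expectedPayoff_blockRound]
  have h1 : ∫ G, bestPayoff (blockRound G m L) - ρ ∂(plantedGraph N p k q) ≤
      ∫ G, A.expectedPayoff (blockRound G m L) ∂(plantedGraph N p k q) :=
    integral_mono .of_finite .of_finite fun G => by
      have := hρ (blockRound G m L)
      simp only
      linarith
  rw [integral_sub .of_finite .of_finite, integral_const, probReal_univ, one_smul] at h1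
  have h2 := le_integral_bestPayoff hp0 hp1 hq0 hq1 hk hkN hN
  linarith

end

/-! ## The parameters of the game -/

theorem coe_blockCount {a b N : ℕ} (hab : a ≤ b) (hb : 0 < b) (hN : 0 < N) :
    (blockCount a b N : ℕ) = ⌊(N : ℝ) ^ ((a : ℝ) / b)⌋₊ + 1 := by
  have hx : ∀ j : ℕ, (j + 1) ^ b ≤ N ^ a ↔ j < ⌊(N : ℝ) ^ ((a : ℝ) / b)⌋₊ := by
    intro j
    rw [← Nat.succ_le_iff, Nat.le_floor_iff (by positivity), Nat.succ_eq_add_one, div_eq_mul_inv,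
      Real.rpow_mul (by positivity), Real.le_rpow_inv_iff_of_pos (by positivity) (by positivity)
        (by positivity), Real.rpow_natCast, Real.rpow_natCast]
    exact_mod_cast Iff.rfl
  -- Because `a ≤ b`, restricting the count to `j < N` in `blockCount` cuts nothing off.
  have hle : ⌊(N : ℝ) ^ ((a : ℝ) / b)⌋₊ ≤ N := by
    refine Nat.floor_le_of_le ?_
    calc (N : ℝ) ^ ((a : ℝ) / b) ≤ (N : ℝ) ^ (1 : ℝ) := by
          refine Real.rpow_le_rpow_of_exponent_le (by exact_mod_cast hN) ?_
          rw [div_le_one (by exact_mod_cast hb)]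
          exact_mod_cast hab
      _ = N := Real.rpow_one _
  rw [blockCount, PNat.mk_coe]
  simp only [decide_eq_true_eq, hx]
  rw [Fin.sum_univ_eq_sum_range (fun j => if j < ⌊(N : ℝ) ^ ((a : ℝ) / b)⌋₊ then 1 else 0),
    Finset.sum_boole, Nat.cast_id, Nat.add_right_cancel_iff]
  rw [show (Finset.range N).filter (fun j => j < ⌊(N : ℝ) ^ ((a : ℝ) / b)⌋₊) =
    Finset.range ⌊(N : ℝ) ^ ((a : ℝ) / b)⌋₊ from ?_, Finset.card_range]
  ext j
  simp only [Finset.mem_filter, Finset.mem_range]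
  omega

theorem blockSize_bounds {m N : ℕ} (hm : 0 < m) (h : 2 * m ≤ N) :
    2 * m * blockSize m N ≤ N ∧ N ≤ 4 * m * blockSize m N := by
  have h1 : 0 < N / (2 * m) := Nat.div_pos h (by omega)
  -- The `- 1 + 1` in `blockSize` only enforces positivity and is neutral here.
  have h2 : (blockSize m N : ℕ) = N / (2 * m) := by
    rw [blockSize, PNat.mk_coe]; omega
  rw [h2]
  have h3 := Nat.div_add_mod N (2 * m)
  have h4 := Nat.mod_lt N (show 0 < 2 * m by omega)
  refine ⟨Nat.mul_div_le _ _, ?_⟩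
  have h5 := Nat.mul_le_mul_left (2 * m) h1
  calc N ≤ 2 * m * (N / (2 * m)) + 2 * m * (N / (2 * m)) := by omega
    _ = 4 * m * (N / (2 * m)) := by ring

theorem Nat.half_le_floor {x : ℝ} (h : 1 ≤ x) : x / 2 ≤ ⌊x⌋₊ := by
  have h1 := Nat.lt_floor_add_one x
  have h2 : (1 : ℝ) ≤ ⌊x⌋₊ := by exact_mod_cast Nat.one_le_floor_iff x |>.2 h
  linarith

theorem eventually_rpow_le {x δ : ℝ} (hx : x < 0) (hδ : 0 < δ) :
    ∀ᶠ N : ℕ in atTop, (N : ℝ) ^ x ≤ δ := by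
  have h := (tendsto_rpow_neg_atTop (neg_pos.2 hx)).comp tendsto_natCast_atTop_atTop
  rw [neg_neg] at h
  exact h.eventually_le_const hδ

/-! ## The test distinguishes the ensembles -/

section

variable {A : Learner} {a b c d N : ℕ}

/-- Taking `d`-th powers clears the fractional exponent; this is why the test can be carried out in
integers. -/
theorem pow_lt_pow_mul_pow_iff {T X : ℕ} (hd : 0 < d) (hN : 0 < N) :
    T ^ d < X ^ d * N ^ c ↔ (T : ℝ) * (N : ℝ) ^ (-((c : ℝ) / d)) < X := by
  have hN' : (0 : ℝ) < N := by exact_mod_cast hN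
  have h1 : ((N : ℝ) ^ ((c : ℝ) / d)) ^ d = (N : ℝ) ^ c := by
    rw [← Real.rpow_natCast, ← Real.rpow_mul hN'.le, div_mul_cancel₀ _ (by exact_mod_cast hd.ne'),
      Real.rpow_natCast]
  rw [Real.rpow_neg hN'.le, ← div_eq_mul_inv, div_lt_iff₀ (by positivity),
    ← pow_lt_pow_iff_left₀ (a := (T : ℝ)) (by positivity) (by positivity) hd.ne', mul_pow, h1]
  exact_mod_cast Iff.rfl

open Classical in
theorem blockTest_answer_eq_true_iff (hd : 0 < d) (hN : 0 < N)
    (r : Fin ((blockCoins A).eval N) → Bool) (G : SimpleGraph (Fin N)) :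
    (blockTest A a b c d).answer N r G = true ↔
      (blockCount a b N * blockCount a b N : ℝ) * (N : ℝ) ^ (-((c : ℝ) / d)) <
        blockScore A G (blockCount a b N) (blockSize (blockCount a b N) N)
          (fun s => r (Fin.castLE (coins_le_blockCoins A a b N) s)) := by
  rw [← Nat.cast_mul, ← pow_lt_pow_mul_pow_iff hd hN]
  exact decide_eq_true_iff

theorem answerProb_false (D : Distinguisher) (μ : Measure (SimpleGraph (Fin N)))
    [IsProbabilityMeasure μ] : D.answerProb μ false = 1 - D.answerProb μ true := by
  rw [Distinguisher.answerProb, Distinguisher.answerProb,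
    ← probReal_compl_eq_one_sub (Set.toFinite _).measurableSet]
  congr 1
  ext x
  simp

theorem le_answerProb_randomGraph {p : ℝ} (hd : 0 < d) (hN : 0 < N) (h0 : 0 ≤ p) (h1 : p ≤ 1) :
    1 - p * (N : ℝ) ^ ((c : ℝ) / d) ≤
      (blockTest A a b c d).answerProb (randomGraph N p) false := by
  have hN' : (0 : ℝ) < N := by exact_mod_cast hN
  have hm : (0 : ℝ) < blockCount a b N := by exact_mod_cast (blockCount a b N).pos
  rw [answerProb_false]
  have h2 := (edgeBound_randomGraph (n := N) h0 h1).real_le_blockScore (A := A) (m := blockCount a b N)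
    (L := blockSize (blockCount a b N) N) (ν := coinLaw ((blockCoins A).eval N)) h0
    (fun r s => r (Fin.castLE (coins_le_blockCoins A a b N) s))
    (θ := (blockCount a b N * blockCount a b N : ℝ) * (N : ℝ) ^ (-((c : ℝ) / d))) (by positivity)
  have h3 : p * (blockCount a b N * blockCount a b N : ℝ) /
      ((blockCount a b N * blockCount a b N : ℝ) * (N : ℝ) ^ (-((c : ℝ) / d))) =
      p * (N : ℝ) ^ ((c : ℝ) / d) := by
    rw [Real.rpow_neg hN'.le]
    field_simp
  rw [h3] at h2
  refine sub_le_sub_left (le_trans (measureReal_mono fun x hx => ?_) h2) _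
  exact ((blockTest_answer_eq_true_iff hd hN _ _).1 hx).le

/-- By `hθ` the threshold is at most half of `q * m²`, so a wrong answer is a lower deviation of the
score. The two terms multiplied by `8` are the loss from blocks that miss `S` and the relative
regret. -/
theorem le_answerProb_plantedGraph {p q ρ : ℝ} {k : ℕ} (hd : 0 < d) (hN : 0 < N) (h0 : 0 ≤ p)
    (hpq : p ≤ q) (hq : 0 < q) (h1 : q ≤ 1) (hk : 0 < k) (hkN : k ≤ N)
    (hm : 2 * blockCount a b N ≤ N)
    (hρ : ∀ x : Fin (blockCount a b N * blockCount a b N : ℕ+) →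
        Round (2 * blockCount a b N : ℕ+) (blockSize (blockCount a b N) N),
      bestPayoff x - A.expectedPayoff x ≤ ρ)
    (hθ : 2 * (N : ℝ) ^ (-((c : ℝ) / d)) ≤ q) :
    1 - (4 / (q * (blockCount a b N * blockCount a b N)) +
        8 * (2 * (N / (k * blockSize (blockCount a b N) N)) +
          ρ / (q * (blockCount a b N * blockCount a b N)))) ≤
      (blockTest A a b c d).answerProb (plantedGraph N p k q) true := by
  have := isProbabilityMeasure_plantedGraph hkN p q
  have hm0 : (0 : ℝ) < blockCount a b N := by exact_mod_cast (blockCount a b N).pos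
  have hE := le_integral_integral_blockScore h0 (hpq.trans h1) hq.le h1 hk hkN
    (blockSize_bounds (blockCount a b N).pos hm).1 hρ
  rw [← integral_coinLaw_castLE (coins_le_blockCoins A a b N)] at hE
  have h2 := (edgeBound_plantedGraph (n := N) (k := k) h0 hpq h1).real_blockScore_le (A := A)
    (ν := coinLaw ((blockCoins A).eval N)) hq
    (fun r s => r (Fin.castLE (coins_le_blockCoins A a b N) s))
    (η := 2 * (N / (k * blockSize (blockCount a b N) N)) +
          ρ / (q * (blockCount a b N * blockCount a b N))) (by
      refine le_trans (le_of_eq ?_) hE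
      field_simp
      ring)
  have h3 := answerProb_false (blockTest A a b c d) (plantedGraph N p k q)
  have h4 : (blockTest A a b c d).answerProb (plantedGraph N p k q) false ≤ _ :=
    le_trans (measureReal_mono fun x hx => ?_) h2
  · linarith
  · simp only [Set.mem_ofPred_eq] at hx ⊢
    have h5 := (blockTest_answer_eq_true_iff hd hN x.2 x.1).not.1 (by rw [hx]; simp)
    refine (not_lt.1 h5).trans ?_
    have h6 := mul_le_mul_of_nonneg_left hθ
      (by positivity : (0 : ℝ) ≤ blockCount a b N * blockCount a b N)
    linarith

end

/-! ### Choice of exponents -/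

theorem exists_nat_div_btwn {x y : ℝ} (hx : 0 ≤ x) (h : x < y) :
    ∃ a b : ℕ, 0 < b ∧ x < (a : ℝ) / b ∧ (a : ℝ) / b < y := by
  obtain ⟨r, h1, h2⟩ := exists_rat_btwn h
  have hr : 0 < r := by exact_mod_cast hx.trans_lt h1
  have h3 : ((r.num.toNat : ℝ) / (r.den : ℝ)) = r := by
    rw [Rat.cast_def, ← Int.cast_natCast, Int.toNat_of_nonneg (Rat.num_pos.2 hr).le]
  exact ⟨r.num.toNat, r.den, r.den_pos, by rwa [h3], by rwa [h3]⟩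

/-- With `κ = 1/2 - e/4` and `μ = a / b`, the three conditions say that `m` is small against `k`,
that `q * m²` tends to infinity, and that `L ^ β` is small against `q² * m`. At `μ = κ` the last
expression equals `3s/8 + e²/4 + 5es/16 > 0`, so rationals slightly below `κ` qualify. -/
theorem exists_block_exponent {e s : ℝ} (he : 0 < e) (hs : 0 < s) (h1 : e + s ≤ 1) :
    ∃ a b : ℕ, 0 < b ∧ (a : ℝ) / b < 1 / 2 - e / 4 ∧ (1 / 2 - e / 4) * s / 8 < 2 * ((a : ℝ) / b) ∧
      0 < (a : ℝ) / b + (a : ℝ) / b * (1 - e - s) - (1 - e - s) - (1 / 2 - e / 4) * s / 4 := by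
  have hβ : 0 ≤ 1 - e - s := by linarith
  have h2 : max ((1 / 2 - e / 4) * s / 16)
      (((1 - e - s) + (1 / 2 - e / 4) * s / 4) / (1 + (1 - e - s))) < 1 / 2 - e / 4 := by
    refine max_lt (by nlinarith) ?_
    rw [div_lt_iff₀ (by linarith)]
    nlinarith [mul_pos he hs, mul_pos he he]
  obtain ⟨a, b, hb, h3, h4⟩ := exists_nat_div_btwn
    ((by nlinarith : 0 ≤ (1 / 2 - e / 4) * s / 16).trans (le_max_left _ _)) h2
  refine ⟨a, b, hb, h4, ?_, ?_⟩
  · have := (le_max_left _ _).trans_lt h3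
    linarith
  · have := (le_max_right _ _).trans_lt h3
    rw [div_lt_iff₀ (by linarith)] at this
    linarith

theorem plantedSize_bounds {e : ℝ} {N : ℕ} (he : e ≤ 1 / 2) (hN : 0 < N) :
    0 < plantedSize e N ∧ (N : ℝ) ^ (1 / 2 - e) / 2 ≤ plantedSize e N ∧
      (plantedSize e N : ℝ) ≤ (N : ℝ) ^ (1 / 2 - e) := by
  have h1 : (1 : ℝ) ≤ (N : ℝ) ^ (1 / 2 - e) :=
    Real.one_le_rpow (by exact_mod_cast hN) (by linarith)
  exact ⟨Nat.floor_pos.2 h1, Nat.half_le_floor h1, Nat.floor_le (by linarith)⟩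

theorem le_rpow_plantedSize {e s : ℝ} {N : ℕ} (he : e ≤ 1 / 2) (hs : 0 ≤ s) (hN : 0 < N) :
    (N : ℝ) ^ (-((1 / 2 - e) * s)) ≤ (plantedSize e N : ℝ) ^ (-s) := by
  obtain ⟨h1, -, h2⟩ := plantedSize_bounds he hN
  rw [← mul_neg, Real.rpow_mul (by positivity)]
  exact Real.rpow_le_rpow_of_nonpos (by exact_mod_cast h1) h2 (by linarith)

/-- On the planted graph the error `1/5` is split into three parts of `1/15`: the variance term `4 /
(q * m²)`, the missed blocks `16 * N / (k * L)` and the regret `8 * ρ / (q * m²)`. The numerical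
thresholds below come from this. -/
theorem Learner.AchievesRegret.exists_distinguishes {A : Learner} {e s α : ℝ}
    (hA : A.AchievesRegret (1 - e - s)) (he : 0 < e) (hs : 0 < s) (h1 : e + s ≤ 1)
    (hα : (1 / 2 - e / 4) * s < α) :
    ∃ a b c d : ℕ, (blockTest A a b c d).Distinguishes (fun n => (n : ℝ) ^ (-α / 8))
      (plantedSize (e / 4)) (fun n => (plantedSize (e / 4) n : ℝ) ^ (-(s / 8))) := by
  obtain ⟨C, hC⟩ := hA
  obtain ⟨a, b, hb, hμκ, hμs, hγ⟩ := exists_block_exponent he hs h1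
  -- The threshold `N ^ (-τ)` has to separate `p = N ^ (-α / 8)` from `q ≥ N ^ (-κ * s / 8)`.
  obtain ⟨c, d, hd, hτ1, hτ2⟩ := exists_nat_div_btwn
    (by nlinarith : 0 ≤ (1 / 2 - e / 4) * s / 8) (show _ < α / 8 by linarith)
  refine ⟨a, b, c, d, ?_⟩
  set μ : ℝ := (a : ℝ) / b with hμ
  set τ : ℝ := (c : ℝ) / d with hτ
  set κ : ℝ := 1 / 2 - e / 4 with hκ
  set β : ℝ := 1 - e - s with hβ
  set γ : ℝ := μ + μ * β - β - κ * s / 4 with hγ'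
  set w : ℝ := 1 / (120 * (|C| + 1)) with hw
  have hβ0 : 0 ≤ β := by linarith
  have hκ0 : 0 < κ := by linarith
  have hμ0 : 0 ≤ μ := by positivity
  have hw0 : 0 < w := by positivity
  have hCw : |C| * w ≤ 1 / 120 := by
    rw [hw, mul_one_div, div_le_div_iff₀ (by positivity) (by positivity)]
    linarith [abs_nonneg C]
  filter_upwards [eventually_rpow_le (show τ - α / 8 < 0 by linarith) (show (0 : ℝ) < 1 / 5 by norm_num),
    eventually_rpow_le (show κ * s / 8 - τ < 0 by linarith) (show (0 : ℝ) < 1 / 2 by norm_num),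
    eventually_rpow_le (show κ * s / 8 - 2 * μ < 0 by linarith) (show (0 : ℝ) < 1 / 60 by norm_num),
    eventually_rpow_le (show μ - κ < 0 by linarith) (show (0 : ℝ) < 1 / 3840 by norm_num),
    eventually_rpow_le (show -γ < 0 by linarith) (show (0 : ℝ) < w ^ 2 / 2 by positivity),
    eventually_rpow_le (show μ - 1 < 0 by linarith) (show (0 : ℝ) < 1 / 4 by norm_num),
    eventually_gt_atTop 0] with N hN1 hN2 hN3 hN4 hN5 hN6 hN
  have hX : (0 : ℝ) < N := by exact_mod_cast hN
  have hX1 : (1 : ℝ) ≤ N := by exact_mod_cast hN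
  obtain ⟨hk0, hk1, hk2⟩ := plantedSize_bounds (e := e / 4) (by linarith) hN
  have hq := le_rpow_plantedSize (e := e / 4) (s := s / 8) (by linarith) (by linarith) hN
  rw [← hκ] at hk1 hk2 hq
  set k := plantedSize (e / 4) N
  set q : ℝ := (k : ℝ) ^ (-(s / 8))
  have hk0' : (0 : ℝ) < k := by exact_mod_cast hk0
  have hq1 : q ≤ 1 := Real.rpow_le_one_of_one_le_of_nonpos (by exact_mod_cast hk0) (by linarith)
  have hq0 : 0 < q := by positivity
  have hkN : k ≤ N := by
    have h2 : (N : ℝ) ^ κ ≤ (N : ℝ) ^ (1 : ℝ) :=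
      Real.rpow_le_rpow_of_exponent_le hX1 (by linarith)
    rw [Real.rpow_one] at h2
    exact_mod_cast hk2.trans h2
  have hp0 : 0 ≤ (N : ℝ) ^ (-α / 8) := by positivity
  have hpq : (N : ℝ) ^ (-α / 8) ≤ q :=
    (Real.rpow_le_rpow_of_exponent_le hX1 (by linarith)).trans hq
  constructor
  · refine le_trans ?_ (le_answerProb_randomGraph hd hN hp0 (hpq.trans hq1))
    rw [← Real.rpow_add hX, show -α / 8 + (c : ℝ) / d = τ - α / 8 by rw [hτ]; ring]
    linarith
  have hab : a ≤ b := by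
    have h2 : (a : ℝ) / b ≤ 1 := by linarith
    rw [div_le_one (by exact_mod_cast hb)] at h2
    exact_mod_cast h2
  have hm := coe_blockCount hab hb hN
  have hμ1 : 1 ≤ (N : ℝ) ^ μ := Real.one_le_rpow hX1 hμ0
  set m := blockCount a b N
  have hm1 : (N : ℝ) ^ μ ≤ m := by
    rw [hm]; exact_mod_cast (Nat.lt_floor_add_one _).le
  have hm2 : (m : ℝ) ≤ 2 * (N : ℝ) ^ μ := by
    have h2 := Nat.floor_le (zero_le_one.trans hμ1)
    rw [hm]
    push_cast
    linarith
  have hm0 : (0 : ℝ) < m := by linarith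
  have h2m : 2 * (m : ℕ) ≤ N := by
    have h2 : (N : ℝ) ^ μ = (N : ℝ) ^ (μ - 1) * N := by
      rw [← Real.rpow_add_one hX.ne', sub_add_cancel]
    have h3 : (N : ℝ) ^ (μ - 1) * N ≤ 1 / 4 * N := by gcongr
    have h4 : (2 : ℝ) * m ≤ N := by linarith
    exact_mod_cast h4
  obtain ⟨hL1, hL2⟩ := blockSize_bounds m.pos h2m
  refine le_trans ?_ (le_answerProb_plantedGraph (ρ := C * √((2 * m : ℕ+) *
    (blockSize m N : ℝ) ^ β * (m * m : ℕ+))) hd hN hp0 hpq hq0 hq1 hk0 hkN h2m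
    (fun x => hC _ _ _ x) ?_)
  swap
  · refine le_trans ?_ hq
    have h2 : (N : ℝ) ^ (-τ) = (N : ℝ) ^ (κ * s / 8 - τ) * (N : ℝ) ^ (-(κ * (s / 8))) := by
      rw [← Real.rpow_add hX]
      ring_nf
    have h3 := mul_le_mul_of_nonneg_right hN2
      (by positivity : 0 ≤ (N : ℝ) ^ (-(κ * (s / 8))))
    rw [h2]
    linarith
  set L := blockSize m N
  have hL0 : (0 : ℝ) < L := by exact_mod_cast L.pos
  have hL1' : 2 * (m : ℝ) * L ≤ N := by exact_mod_cast hL1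
  have hL2' : (N : ℝ) ≤ 4 * m * L := by exact_mod_cast hL2
  have t1 : 4 / (q * (m * m)) ≤ 1 / 15 := by
    have h2 : (N : ℝ) ^ (-(κ * (s / 8))) * ((N : ℝ) ^ μ * (N : ℝ) ^ μ) ≤ q * (m * m) := by gcongr
    rw [← Real.rpow_add hX, ← Real.rpow_add hX] at h2
    have h3 : (N : ℝ) ^ (-(κ * (s / 8)) + (μ + μ)) * (N : ℝ) ^ (κ * s / 8 - 2 * μ) = 1 := by
      rw [← Real.rpow_add hX, show -(κ * (s / 8)) + (μ + μ) + (κ * s / 8 - 2 * μ) = 0 by ring,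
        Real.rpow_zero]
    rw [div_le_iff₀ (by positivity)]
    have h4 := mul_le_mul h2 hN3 (by positivity) (by positivity)
    rw [h3] at h4
    linarith
  have t2 : N / (k * L) ≤ (1 : ℝ) / 240 := by
    rw [div_le_iff₀ (by positivity)]
    have h2 : (N : ℝ) ^ μ = (N : ℝ) ^ (μ - κ) * (N : ℝ) ^ κ := by
      rw [← Real.rpow_add hX, sub_add_cancel]
    have h3 := mul_le_mul hN4 (by linarith : (N : ℝ) ^ κ ≤ 2 * k) (by positivity) (by norm_num)
    rw [← h2] at h3
    have h4 : 4 * (m : ℝ) ≤ 1 / 240 * k := by linarith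
    have h5 := mul_le_mul_of_nonneg_right h4 hL0.le
    linarith
  have t3 : C * √((2 * m : ℕ+) * (L : ℝ) ^ β * (m * m : ℕ+)) / (q * (m * m)) ≤ 1 / 120 := by
    have h2 : (L : ℝ) ≤ (N : ℝ) ^ (1 - μ) := by
      rw [Real.rpow_sub hX, Real.rpow_one, le_div_iff₀ (by positivity)]
      have h3 := mul_le_mul_of_nonneg_left hm1 hL0.le
      have h4 : 0 ≤ (m : ℝ) * L := by positivity
      linarith
    have h3 : (L : ℝ) ^ β ≤ (N : ℝ) ^ ((1 - μ) * β) := by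
      rw [Real.rpow_mul hX.le]
      exact Real.rpow_le_rpow hL0.le h2 hβ0
    -- `γ` is the exponent by which the lower bound for `q² * m` beats the upper bound for `L ^ β`.
    have h4 : (N : ℝ) ^ ((1 - μ) * β) = (N : ℝ) ^ (-(κ * (s / 8))) * (N : ℝ) ^ (-(κ * (s / 8))) *
        (N : ℝ) ^ μ * (N : ℝ) ^ (-γ) := by
      rw [← Real.rpow_add hX, ← Real.rpow_add hX, ← Real.rpow_add hX]
      congr 1
      rw [hγ']
      ring
    have h5 : (L : ℝ) ^ β ≤ q * q * m * (w ^ 2 / 2) := by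
      rw [h4] at h3
      exact h3.trans (by gcongr)
    have h6 : √((2 * m : ℕ+) * (L : ℝ) ^ β * (m * m : ℕ+)) ≤ q * (m * m) * w := by
      refine Real.sqrt_le_iff.2 ⟨by positivity, ?_⟩
      rw [PNat.mul_coe, PNat.mul_coe, PNat.val_ofNat]
      push_cast
      have h7 := mul_le_mul_of_nonneg_left h5 (by positivity : (0 : ℝ) ≤ 2 * m * (m * m))
      linarith
    rw [div_le_iff₀ (by positivity)]
    calc C * √((2 * m : ℕ+) * (L : ℝ) ^ β * (m * m : ℕ+))
        ≤ |C| * (q * (m * m) * w) := by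
          refine mul_le_mul (le_abs_self C) h6 (Real.sqrt_nonneg _) (abs_nonneg C)
      _ = |C| * w * (q * (m * m)) := by ring
      _ ≤ 1 / 120 * (q * (m * m)) := by gcongr
  linarith

/-- One item, one round, and payoff `1` only for answering a hidden label twice. Two choices of the
hidden label give the same view, so the two expected payoffs sum to at most `1` and the regrets to
at least `1`, while `L ^ β` tends to `0`. -/
theorem Learner.not_achievesRegret_of_neg (A : Learner) {β : ℝ} (hβ : β < 0) :
    ¬ A.AchievesRegret β := by
  rintro ⟨C, hC⟩
  have key : ∀ L : ℕ, 2 ≤ L → 1 ≤ 2 * C * √((L : ℝ) ^ β) := by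
    intro L hL
    let L' : ℕ+ := ⟨L, by omega⟩
    let x : Fin L' → Fin (1 : ℕ+) → Round (1 : ℕ+) L' := fun c _ =>
      { i := ⟨0, by simp⟩
        j := ⟨0, by simp⟩
        payoff := fun a b => if a = c ∧ b = c then 1 else 0
        abs_payoff_le := fun a b => by split_ifs <;> simp }
    have hsum : ∀ f : Fin (1 : ℕ+) → ℝ, ∑ t, f t = f ⟨0, by simp⟩ := fun f => Fin.sum_univ_one f
    have hbest : ∀ c, 1 ≤ bestPayoff (T := 1) (x c) := by
      intro c
      refine le_trans (le_of_eq ?_) (le_ciSup (f := fun l : Fin (1 : ℕ+) → Fin L' =>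
        ∑ t, ((x c t).payoff (l (x c t).i) (l (x c t).j) : ℝ))
        (Set.finite_range _).bddAbove fun _ => c)
      simp only [hsum]
      simp [x]
    let c₀ : Fin L' := ⟨0, by change 0 < L; omega⟩
    let c₁ : Fin L' := ⟨1, by change 1 < L; omega⟩
    have hview : viewAt (T := (1 : ℕ+)) (x c₀) ⟨0, by simp⟩ = viewAt (x c₁) ⟨0, by simp⟩ := rfl
    have hpay : ∀ r, A.totalPayoff (T := 1) (x c₀) r + A.totalPayoff (T := 1) (x c₁) r ≤ 1 := by
      intro r
      simp only [Learner.totalPayoff, hsum, hview]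
      generalize A.label 1 L' 1 r (viewAt (x c₁) ⟨0, by simp⟩) = l
      by_cases h : l.1 = c₀
      · have h' : l.1 ≠ c₁ := by rw [h]; simp [c₀, c₁]
        simp only [x, h', false_and, if_false]
        split_ifs <;> simp
      · simp only [x, h, false_and, if_false]
        split_ifs <;> simp
    have hexp : A.expectedPayoff (T := 1) (x c₀) + A.expectedPayoff (T := 1) (x c₁) ≤ 1 := by
      rw [Learner.expectedPayoff, Learner.expectedPayoff, ← integral_add .of_finite .of_finite]
      refine (integral_mono .of_finite .of_finite hpay).trans ?_
      rw [integral_const, probReal_univ, one_smul]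
    have h0 := hC 1 L' 1 (x c₀)
    have h1 := hC 1 L' 1 (x c₁)
    have h2 := hbest c₀
    have h3 := hbest c₁
    have h4 : ((1 : ℕ+) : ℝ) * ((L' : ℕ) : ℝ) ^ β * ((1 : ℕ+) : ℝ) = (L : ℝ) ^ β := by
      rw [PNat.one_coe, Nat.cast_one, one_mul, mul_one]
      rfl
    rw [h4] at h0 h1
    linarith
  set w : ℝ := 1 / (4 * (|C| + 1)) with hw
  have hw0 : 0 < w := by positivity
  have hCw : |C| * w ≤ 1 / 4 := by
    rw [hw, mul_one_div, div_le_div_iff₀ (by positivity) (by positivity)]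
    linarith [abs_nonneg C]
  obtain ⟨L, hL, hL2⟩ := ((eventually_rpow_le hβ (show 0 < w ^ 2 by positivity)).and
    (eventually_ge_atTop 2)).exists
  have h1 : √((L : ℝ) ^ β) ≤ w := Real.sqrt_le_iff.2 ⟨hw0.le, hL⟩
  have h2 := mul_le_mul (le_abs_self C) h1 (Real.sqrt_nonneg _) (abs_nonneg C)
  linarith [key L hL2]

/-! ### Conclusion -/

theorem Learner.AchievesRegret.mono {A : Learner} {β β' : ℝ} (hA : A.AchievesRegret β)
    (h : β ≤ β') : A.AchievesRegret β' := by
  obtain ⟨C, hC⟩ := hA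
  refine ⟨|C|, fun n L T x => (hC n L T x).trans ?_⟩
  refine mul_le_mul (le_abs_self C) (Real.sqrt_le_sqrt ?_) (Real.sqrt_nonneg _) (abs_nonneg C)
  have : (1 : ℝ) ≤ L := by exact_mod_cast L.pos
  gcongr

theorem exists_distinguisher {ε' α ε : ℝ} (hε' : 0 < ε') (hα : 0 < α) (hε : 0 < ε) (hεα : ε ≤ α)
    (h : ∃ A : Learner, A.PolyTime ∧ A.AchievesRegret (1 - ε' - α - ε)) :
    ∃ D : Distinguisher, D.PolyTime ∧
      D.Distinguishes (fun n => (n : ℝ) ^ (-α / 8)) (plantedSize (ε' / 4))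
        (fun n => (plantedSize (ε' / 4) n : ℝ) ^ (-α / 8 - ε / 8)) := by
  obtain ⟨A, hP, hA⟩ := h
  rcases lt_or_ge (1 - ε' - α - ε) 0 with hneg | hpos
  · exact absurd hA (A.not_achievesRegret_of_neg hneg)
  rw [sub_sub _ α ε] at hA
  -- Here `ε ≤ α` enters: `(α + ε) / 2 ≤ α`, and the factor `1/2 - ε'/4` is strictly below `1/2`.
  obtain ⟨a, b, c, d, hD⟩ := hA.exists_distinguishes (α := α) hε' (by linarith) (by linarith)
    (by nlinarith)
  refine ⟨blockTest A a b c d, blockTest_polyTime hP a b c d, ?_⟩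
  rwa [show -((α + ε) / 8) = -α / 8 - ε / 8 by ring] at hD

theorem isLittleO_rpow_plantedSize {e s x : ℝ} (he : e ≤ 1 / 2) (hs : 0 ≤ s)
    (h : (1 / 2 - e) * s < x) :
    (fun n : ℕ => (n : ℝ) ^ (-x)) =o[atTop] fun n : ℕ => (plantedSize e n : ℝ) ^ (-s) := by
  rw [Asymptotics.isLittleO_iff]
  intro δ hδ
  filter_upwards [eventually_rpow_le (show (1 / 2 - e) * s - x < 0 by linarith) hδ,
    eventually_gt_atTop 0] with N h1 hN
  have hX : (0 : ℝ) < N := by exact_mod_cast hN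
  rw [Real.norm_of_nonneg (by positivity), Real.norm_of_nonneg (by positivity)]
  refine le_trans (le_of_eq ?_) (mul_le_mul h1 (le_rpow_plantedSize he hs hN) (by positivity) hδ.le)
  rw [← Real.rpow_add hX]
  ring_nf

theorem corollary2 :
    (∀ ε' α ε : ℝ, 0 < ε' → 0 < α → 0 < ε → ε ≤ α →
      (∃ A : Learner, A.PolyTime ∧ A.AchievesRegret (1 - ε' - α - ε)) →
      ∃ D : Distinguisher, D.PolyTime ∧
        D.Distinguishes (fun n => (n : ℝ) ^ (-α / 8)) (plantedSize (ε' / 4))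
          (fun n => (plantedSize (ε' / 4) n : ℝ) ^ (-α / 8 - ε / 8))) ∧
    (PlantedDenseSubgraphConjecture →
      ∀ δ : ℝ, 0 < δ → ¬ ∃ A : Learner, A.PolyTime ∧ A.AchievesRegret (1 - δ)) := by
  refine ⟨fun ε' α ε h1 h2 h3 h4 h => exists_distinguisher h1 h2 h3 h4 h, ?_⟩
  rintro hconj δ hδ ⟨A, hP, hA⟩
  -- All three constants are set to `x`; the cap at `1` brings `x / 4` and `x / 8` into the ranges
  -- of the conjecture.
  obtain ⟨x, hx0, hx1, hxδ⟩ : ∃ x : ℝ, 0 < x ∧ x ≤ 1 ∧ 3 * x ≤ δ :=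
    ⟨min (δ / 3) 1, by positivity, min_le_right _ _, by linarith [min_le_left (δ / 3) 1]⟩
  obtain ⟨D, hDP, hD⟩ := exists_distinguisher hx0 hx0 hx0 le_rfl
    ⟨A, hP, hA.mono (show 1 - δ ≤ 1 - x - x - x by linarith)⟩
  refine hconj (x / 4) (x / 8) (x / 8) (by linarith) (by linarith) (by linarith) (by linarith)
    (by linarith) ?_ ⟨D, hDP, ?_⟩
  · rw [show -(x / 8) - x / 8 = -(x / 4) by ring]
    exact isLittleO_rpow_plantedSize (by linarith) (by linarith) (by nlinarith)
  · rwa [neg_div] at hD
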